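/- Let $n\ge 1$ and let $f\in\mathbb C[x_1^{\pm1},\dots,x_n^{\pm1}]$ be a Laurent polynomial whose Newton polytope (the convex hull in $\mathbb R^n$ of the exponents of $f$) contains $0$ in its interior. Let $\phi_f(i)$ be the constant term of $f^i$ and $\Phi_f(t)=\sum_{i\ge0}\phi_f(i)t^i\in\mathbb C[[t]]$. For $t\neq0$ put $F_t=1-tf$ and $Y_t=\{F_t=0\}\subset(\mathbb C^*)^n$. Then there is an algebraic fiberwise $(n-1)$-form $\omega_t$ on the pencil $\{Y_t\}$ (its coefficients are Laurent polynomials in $x$ over $\mathbb C(t)$) such that: (1) for some $\varepsilon>0$ and all $0<|t|<\varepsilon$, the form $\omega_t$ is the Poincaré residue along $Y_t$ of $$\frac{1}{(2\pi i)^{n-1}}\,\frac{1}{1-tf}\,\frac{dx_1}{x_1}\wedge\dots\wedge\frac{dx_n}{x_n},$$ that is, $dF_t\wedge\omega_t=(2\pi i)^{-(n-1)}\frac{dx_1}{x_1}\wedge\dots\wedge\frac{dx_n}{x_n}$ at every point of $Y_t$ (in particular $Y_t$ is smooth); and every $t_0$ with $0<|t_0|<\varepsilon$ has an open neighbourhood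 $D$ with a family of singular $(n-1)$-cycles $\Delta_t\subset Y_t$, $t\in D$, depending smoothly on $t$, such that for all $t\in D$ the series $\Phi_f(t)$ converges and $$\Phi_f(t)=\int_{\Delta_t}\omega_t .$$ (2) $\Phi_f$ is a solution of the Picard--Fuchs equation of the pencil: if $L=\sum_k a_k(t)\,(d/dt)^k\ne0$, $a_k\in\mathbb C[t]$, annihilates all periods $\int_{\gamma_t}\omega_t$, where $\gamma_t\subset Y_t$ is any smooth family of singular $(n-1)$-cycles over an open set of parameters $t\ne0$ for which $\omega_t$ is the residue form in (1), then $L\Phi_f=0$ in $\mathbb C[[t]]$. -/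

import Mathlib

noncomputable section

namespace LaurentPencil

/-- Laurent polynomials `R[ℤⁿ]` in `n` variables. -/
abbrev LaurentPoly (R : Type) [Semiring R] (n : ℕ) : Type := AddMonoidAlgebra R (Fin n → ℤ)

/-- The monomial `x₁^{a₁} ⋯ xₙ^{aₙ}`. -/
def monom {n : ℕ} (a : Fin n → ℤ) (x : Fin n → ℂ) : ℂ := ∏ i, x i ^ a i

/-- The value of a Laurent polynomial at a point (used only where all coordinates are nonzero). -/
def eval {n : ℕ} (f : LaurentPoly ℂ n) (x : Fin n → ℂ) : ℂ :=
  f.coeff.sum fun a c => c * monom a x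

/-- The Newton polytope, in `ℝⁿ`. -/
def newtonPolytope {n : ℕ} (f : LaurentPoly ℂ n) : Set (Fin n → ℝ) :=
  convexHull ℝ ((fun (a : Fin n → ℤ) (i : Fin n) => (a i : ℝ)) '' (f.coeff.support : Set (Fin n → ℤ)))

/-- The constant term `φ_f(i)` of `f ^ i`. -/
def constTerm {n : ℕ} (f : LaurentPoly ℂ n) (i : ℕ) : ℂ := (f ^ i).coeff 0

/-- The constant terms series `Φ_f`. -/
def constTermSeries {n : ℕ} (f : LaurentPoly ℂ n) : PowerSeries ℂ := PowerSeries.mk (constTerm f)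

/-- The function `F_t = 1 - t f`. -/
def pencilFun {n : ℕ} (f : LaurentPoly ℂ n) (t : ℂ) (x : Fin n → ℂ) : ℂ := 1 - t * eval f x

/-- The fibre `Y_t = (F_t = 0)` of the pencil, a hypersurface in the torus `(ℂ^*)ⁿ`. -/
def fiber {n : ℕ} (f : LaurentPoly ℂ n) (t : ℂ) : Set (Fin n → ℂ) :=
  {x | (∀ i, x i ≠ 0) ∧ pencilFun f t x = 0}

/-! ### Differential forms and Poincaré residues -/

/-- Holomorphic-type `k`-forms on `ℂⁿ`: at every point a `ℂ`-multilinear alternating map. -/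
abbrev Form (n k : ℕ) : Type := (Fin n → ℂ) → (Fin n → ℂ) [⋀^Fin k]→ₗ[ℂ] ℂ

/-- The form `dx₁/x₁ ∧ … ∧ dxₙ/xₙ`. -/
def dlogVol (n : ℕ) : Form n n := fun x =>
  (Matrix.detRowAlternating (R := ℂ) (n := Fin n)).compLinearMap
    (LinearMap.pi fun k => (x k)⁻¹ • LinearMap.proj k)

/-- The form `dx₁/x₁ ∧ … ∧ dxₙ/xₙ` with the factor number `i` left out, `n = m + 1`. -/
def dlogOmit (m : ℕ) (i : Fin (m + 1)) : Form (m + 1) m := fun x =>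
  (Matrix.detRowAlternating (R := ℂ) (n := Fin m)).compLinearMap
    (LinearMap.pi fun k => (x (i.succAbove k))⁻¹ • LinearMap.proj (i.succAbove k))

/-- The wedge product `α ∧ η` of a covector and an alternating `k`-form:
`(α ∧ η)(v₀, …, v_k) = ∑ᵢ (-1)ⁱ α(vᵢ) η(v₀, …, v̂ᵢ, …, v_k)`. -/
def wedgeCovector {n k : ℕ} (α : (Fin n → ℂ) →ₗ[ℂ] ℂ) (η : (Fin n → ℂ) [⋀^Fin k]→ₗ[ℂ] ℂ) :
    (Fin n → ℂ) [⋀^Fin (k + 1)]→ₗ[ℂ] ℂ :=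
  AlternatingMap.alternatizeUncurryFin (LinearMap.smulRight α η)

/-- `η` restricts to the Poincaré residue along the smooth hypersurface `Y = (F = 0)` of the
top-degree form `Θ / F` with a simple pole: `dF ∧ η = Θ` at the points of `Y`. Where `Θ ≠ 0` this
forces `dF ≠ 0`, and it determines `η` on the tangent spaces `ker dF` of `Y`. -/
def IsPoincareResidue {m : ℕ} (Y : Set (Fin (m + 1) → ℂ)) (F : (Fin (m + 1) → ℂ) → ℂ)
    (Θ : Form (m + 1) (m + 1)) (η : Form (m + 1) m) : Prop :=
  ∀ x ∈ Y, wedgeCovector (fderiv ℂ F x : (Fin (m + 1) → ℂ) →ₗ[ℂ] ℂ) (η x) = Θ x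

/-- A fiberwise algebraic form of degree `m = n - 1` on the pencil, regular over a Zariski open
part of the base: `∑ᵢ cᵢ(t, x) / d(t) · ⋀_{k ≠ i} dx_k/x_k`, where the `cᵢ` are Laurent polynomials
in `x` whose coefficients are polynomials in `t`, and `d ≠ 0`. -/
structure RelativeForm (m : ℕ) where
  /-- the common denominator `d` -/
  den : Polynomial ℂ
  den_ne_zero : den ≠ 0
  /-- the numerators `cᵢ` -/
  num : Fin (m + 1) → LaurentPoly (Polynomial ℂ) (m + 1)

/-- The value of the form at the parameter `t`. -/
def RelativeForm.at {m : ℕ} (ω : RelativeForm m) (t : ℂ) : Form (m + 1) m := fun x =>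
  ∑ i, (((ω.num i).coeff.sum fun a p => p.eval t * monom a x) / ω.den.eval t) • dlogOmit m i x

/-- On `Y_t`, the form `ω_t` is the Poincaré residue of
`(2πi)^{-(n-1)} · 1 / (1 - t f) · dx₁/x₁ ∧ … ∧ dxₙ/xₙ`, where `n = m + 1`. -/
def IsResidueAt {m : ℕ} (f : LaurentPoly ℂ (m + 1)) (ω : RelativeForm m) (t : ℂ) : Prop :=
  IsPoincareResidue (fiber f t) (pencilFun f t)
    (fun x => ((2 * (Real.pi : ℂ) * Complex.I) ^ m)⁻¹ • dlogVol (m + 1) x) (ω.at t)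

/-! ### Cubical singular chains, cycles, integration -/

/-- Singular `k`-cubes. -/
abbrev SCube (X : Type) (k : ℕ) : Type := (Fin k → unitInterval) → X

/-- Singular cubical `k`-chains with integer coefficients. -/
abbrev SChain (X : Type) (k : ℕ) : Type := SCube X k →₀ ℤ

/-- The face of a cube on which the coordinate number `i` equals `e`. -/
def SCube.face {X : Type} {k : ℕ} (σ : SCube X (k + 1)) (i : Fin (k + 1)) (e : unitInterval) : SCube X k :=
  fun θ => σ (i.insertNth (α := fun _ => unitInterval) e θ)

/-- A cube is degenerate if it does not depend on one of its coordinates. -/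
def SCube.IsDegenerate {X : Type} {k : ℕ} (σ : SCube X k) : Prop :=
  ∃ i : Fin k, ∀ (θ : Fin k → unitInterval) (s : unitInterval), σ (Function.update θ i s) = σ θ

/-- The chains that are combinations of degenerate cubes. -/
def degenerateChains (X : Type) (k : ℕ) : AddSubgroup (SChain X k) :=
  AddSubgroup.closure {c | ∃ σ : SCube X k, σ.IsDegenerate ∧ c = Finsupp.single σ 1}

/-- The cubical boundary. -/
def SChain.boundary {X : Type} {k : ℕ} (c : SChain X (k + 1)) : SChain X k :=
  c.sum fun σ a => a • ∑ i : Fin (k + 1),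
    (-1 : ℤ) ^ (i : ℕ) • (Finsupp.single (σ.face i 1) (1 : ℤ) - Finsupp.single (σ.face i 0) 1)

/-- Cycles of the normalized cubical complex (cubical chains modulo degenerate ones). -/
def SChain.IsCycle {X : Type} : {k : ℕ} → SChain X k → Prop
  | 0, _ => True
  | _ + 1, c => c.boundary ∈ degenerateChains X _

/-- The projection of `ℝᵏ` onto the unit cube, which is the identity on the cube. -/
def clampCube {k : ℕ} (θ : Fin k → ℝ) : Fin k → unitInterval :=
  fun i => Set.projIcc (0 : ℝ) 1 zero_le_one (θ i)

/-- The integral of a `k`-form over a (smooth) singular `k`-cube `σ`: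
`∫_{[0,1]^k} η_{σ(θ)}(∂₁σ, …, ∂_kσ) dθ`. -/
def integralCube {n k : ℕ} (η : Form n k) (σ : SCube (Fin n → ℂ) k) : ℂ :=
  ∫ θ in Set.Icc (0 : Fin k → ℝ) 1,
    η (σ (clampCube θ)) fun j =>
      fderivWithin ℝ (fun θ' => σ (clampCube θ')) (Set.Icc 0 1) θ (Pi.single j 1)

/-- The integral of a `k`-form over a singular chain. -/
def integralChain {n k : ℕ} (η : Form n k) (c : SChain (Fin n → ℂ) k) : ℂ :=
  c.sum fun σ a => (a : ℂ) * integralCube η σ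

/-- A fiberwise `(n-1)`-cycle of the pencil over a set `D` of parameters (`n = m + 1`): a fixed
integer combination of singular `m`-cubes `σⱼ(t) : [0,1]^m → Y_t` that depend smoothly on `t ∈ D`
and on the point of the cube, such that the combination is a cycle for every `t ∈ D`. The homology
classes of the cycles are thus locally constant in `t`. -/
structure CycleFamily {m : ℕ} (f : LaurentPoly ℂ (m + 1)) (D : Set ℂ) where
  /-- the number of cubes -/
  size : ℕ
  /-- the coefficients -/
  coef : Fin size → ℤ
  /-- the cubes -/
  cube : Fin size → ℂ → SCube (Fin (m + 1) → ℂ) m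
  smooth : ∀ j, ContDiffOn ℝ (⊤ : ℕ∞) (fun p : ℂ × (Fin m → ℝ) => cube j p.1 (clampCube p.2))
    (D ×ˢ Set.Icc 0 1)
  mem_fiber : ∀ j, ∀ t ∈ D, ∀ θ, cube j t θ ∈ fiber f t
  isCycle : ∀ t ∈ D, SChain.IsCycle (∑ j, Finsupp.single (cube j t) (coef j))

/-- The cycle `Δ_t` of the family. -/
def CycleFamily.chain {m : ℕ} {f : LaurentPoly ℂ (m + 1)} {D : Set ℂ} (Δ : CycleFamily f D)
    (t : ℂ) : SChain (Fin (m + 1) → ℂ) m :=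
  ∑ j, Finsupp.single (Δ.cube j t) (Δ.coef j)

/-- The period `∫_{Δ_t} ω_t`. -/
def period {m : ℕ} {f : LaurentPoly ℂ (m + 1)} {D : Set ℂ} (ω : RelativeForm m)
    (Δ : CycleFamily f D) (t : ℂ) : ℂ :=
  integralChain (ω.at t) (Δ.chain t)

/-! ### Differential operators and the Picard–Fuchs equation -/

/-- Differential operators `∑ₖ aₖ(t) (d/dt)ᵏ` with polynomial coefficients; `aₖ` is the
coefficient number `k` of the outer polynomial. -/
abbrev DiffOp : Type := Polynomial (Polynomial ℂ)

/-- The value at `t` of the operator applied to a function. -/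
def DiffOp.applyFun (L : DiffOp) (p : ℂ → ℂ) (t : ℂ) : ℂ :=
  L.sum fun k a => a.eval t * iteratedDeriv k p t

/-- The operator applied to a formal power series. -/
def DiffOp.applySeries (L : DiffOp) (Φ : PowerSeries ℂ) : PowerSeries ℂ :=
  L.sum fun k a => (a : PowerSeries ℂ) * (PowerSeries.derivative ℂ)^[k] Φ

/-- `L = 0` is a Picard–Fuchs equation of the pencil `{Y_t}` with the fiberwise form `ω_t`: `L` is
a nonzero operator that annihilates all periods `∫_{γ_t} ω_t`, for all fiberwise cycles `γ_t`
defined over open sets of parameters `t ≠ 0` for which `ω_t` is the residue form on `Y_t`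
(so that `Y_t` is smooth). The operators of minimal order with this property are included. -/
def IsPicardFuchs {m : ℕ} (f : LaurentPoly ℂ (m + 1)) (ω : RelativeForm m) (L : DiffOp) : Prop :=
  L ≠ 0 ∧ ∀ D : Set ℂ, IsOpen D → (∀ t ∈ D, t ≠ 0 ∧ IsResidueAt f ω t) →
    ∀ γ : CycleFamily f D, ∀ t ∈ D, L.applyFun (period ω γ) t = 0

end LaurentPencil

end

/-! Classically, `Φ_f(t)` is the integral of `(2πi)^{-n} dlog x₀ ∧ … ∧ dlog x_m / (1 - t f)` over a
torus, and integrating out one variable by residues turns it into a period on `Y_t`. The proof makes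
both the form and the cycle explicit.

The form: `f` has finitely many critical values on the torus. Algebraically, some nonzero `P(f)`
equals `∑ bᵢ xᵢ ∂f/∂xᵢ` (`exists_aeval_mem_span_eulerDeriv`). On `Y_t` one has `f = 1/t`, so
dividing by `P(1/t)` writes 1 as a combination of the logarithmic derivatives of `f`. The same
coefficients give a residue form wherever `P(1/t) ≠ 0`, hence for all small `t ≠ 0`
(`exists_residueForm`).

The cycle: as `0` is interior to the Newton polytope, `f` has a term `c x^v` of least degree `-N <
0` in `x₀` that dominates the others on a suitable torus. With `x₀ = r₀ s` and `xⱼ = rⱼ exp(2πi θⱼ)`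
for `j ≥ 1`, the equation `t f = 1` becomes `s = w (1 + perturb)^{1/N}`, where `w` is an `N`-th root
of `t c χ_v(θ)`, the radii being absorbed in `c`. It has a unique small solution `s = S(w, θ)`,
holomorphic in `w`. Letting `θ` run over the unit cube and `w` over all `N` roots gives cubes whose
faces cancel (`isCycle_sum_cycleCube`).

The period: the residue form pulls back to `N⁻¹ (w S'/S) dθ` (`residue_pullback`). Expand `w S'/S`
in powers of `w` by Cauchy's formula. Summing over the roots keeps only the powers `w^{Ni}`, and
since `f = c χ_v / w^N` along the solution, their coefficients are the integrals of `f^i dlog S`,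
that is, constant terms in `x₀` (`hasSum_partialConstTerm`). Integration over `θ` extracts the full
constant term (`hasSum_constTerm`).

Picard–Fuchs: near each small `t ≠ 0` the sum of `Φ_f` is a period, so `L` kills it on a punctured
disc. It is analytic at `0`, so `L` kills its Taylor series. -/

noncomputable section

/-! ### Finiteness of the critical values of a Laurent polynomial -/

namespace LaurentPencil
open Polynomial TensorProduct

/-- The logarithmic derivative `x_i ∂f/∂x_i` of a Laurent polynomial. -/
def eulerDeriv {n : ℕ} (i : Fin n) (f : LaurentPoly ℂ n) : LaurentPoly ℂ n :=
  f.coeff.sum fun a c => AddMonoidAlgebra.single a ((a i : ℂ) * c)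

/-- A `ℂ`-derivation maps a value `φ f` of a Laurent polynomial to
`∑ᵢ φ (x_i ∂f/∂x_i) dlog φ(x_i)`. -/
lemma derivation_algHom_apply {n : ℕ} {L M : Type*} [Field L] [Algebra ℂ L] [AddCommGroup M]
    [Module ℂ M] [Module L M] [IsScalarTower ℂ L M] (d : Derivation ℂ L M)
    (φ : LaurentPoly ℂ n →ₐ[ℂ] L) (f : LaurentPoly ℂ n) :
    d (φ f) = ∑ i, φ (eulerDeriv i f) •
      ((φ (AddMonoidAlgebra.single (Pi.single i 1) 1))⁻¹ •
        d (φ (AddMonoidAlgebra.single (Pi.single i 1) 1))) := by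
  set δ : Fin n → M := fun i => (φ (AddMonoidAlgebra.single (Pi.single i 1) 1))⁻¹ •
        d (φ (AddMonoidAlgebra.single (Pi.single i 1) 1)) with hδ
  have hne : ∀ a : Fin n → ℤ, φ (AddMonoidAlgebra.single a 1) ≠ 0 := by
    intro a h
    have : φ (AddMonoidAlgebra.single a 1) * φ (AddMonoidAlgebra.single (-a) 1) = 1 := by
      rw [← map_mul, AddMonoidAlgebra.single_mul_single]
      simp [← AddMonoidAlgebra.one_def]
    rw [h, zero_mul] at this
    exact zero_ne_one this
  -- the logarithmic differential of a monomial, as an additive map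
  let lg : (Fin n → ℤ) →+ M :=
    { toFun := fun a => (φ (AddMonoidAlgebra.single a 1))⁻¹ • d (φ (AddMonoidAlgebra.single a 1))
      map_zero' := by
        rw [← AddMonoidAlgebra.one_def]
        simp
      map_add' := by
        intro a b
        have : (AddMonoidAlgebra.single (a + b) 1 : LaurentPoly ℂ n) =
          AddMonoidAlgebra.single a 1 * AddMonoidAlgebra.single b 1 := by
          simp [AddMonoidAlgebra.single_mul_single]
        rw [this, map_mul, Derivation.leibniz, smul_add, smul_smul, smul_smul, mul_inv, add_comm]
        congr 2
        · rw [mul_assoc, inv_mul_cancel₀ (hne b), mul_one]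
        · rw [mul_right_comm, inv_mul_cancel₀ (hne a), one_mul] }
  have hlg : ∀ a, lg a = ∑ i, a i • δ i := by
    intro a
    conv_lhs => rw [← Finset.univ_sum_single a]
    rw [map_sum]
    refine Finset.sum_congr rfl fun i _ => ?_
    have : (Pi.single i (a i) : Fin n → ℤ) = a i • Pi.single i 1 := by
      rw [← Pi.single_smul]; simp
    rw [this, map_zsmul]
    rfl
  have hmon : ∀ a (c : ℂ), d (φ (AddMonoidAlgebra.single a c)) =
      φ (AddMonoidAlgebra.single a c) • lg a := by
    intro a c
    have : (AddMonoidAlgebra.single a c : LaurentPoly ℂ n) =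
        c • AddMonoidAlgebra.single a 1 := by simp
    rw [this, map_smul, Derivation.map_smul]
    change _ = _ • ((φ (AddMonoidAlgebra.single a 1))⁻¹ • d (φ (AddMonoidAlgebra.single a 1)))
    rw [smul_smul, smul_mul_assoc, mul_inv_cancel₀ (hne a)]
    rw [Algebra.smul_def, mul_one, algebraMap_smul]
  induction f using AddMonoidAlgebra.induction_linear with
  | zero => simp [eulerDeriv]
  | add f g hf hg =>
    have : ∀ i, eulerDeriv i (f + g) = eulerDeriv i f + eulerDeriv i g := by
      intro i
      unfold eulerDeriv
      rw [AddMonoidAlgebra.coeff_add, Finsupp.sum_add_index'] <;> simp [mul_add]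
    simp only [map_add, hf, hg, this, add_smul, Finset.sum_add_distrib]
  | single a c =>
    rw [hmon, hlg, Finset.smul_sum]
    refine Finset.sum_congr rfl fun i _ => ?_
    have : eulerDeriv i (AddMonoidAlgebra.single a c) = (a i : ℂ) • AddMonoidAlgebra.single a c := by
      unfold eulerDeriv
      simp
    rw [this, map_smul, smul_assoc]
    change _ = _ • _ • δ i
    rw [Int.cast_smul_eq_zsmul, smul_comm]

/-- Étale base change identifies the differentials of `L` with `L ⊗ Ω[k[X]/k]`, and `Ω[k[X]/k]` is
free on `dX`; under this identification `dX` becomes `1`. -/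
lemma D_algebraMap_X_ne_zero (k L : Type) [Field k] [Field L] [Algebra k L] [Algebra k[X] L]
    [IsScalarTower k k[X] L] [Algebra.FormallyEtale k[X] L] :
    KaehlerDifferential.D k L (algebraMap k[X] L X) ≠ 0 := by
  intro hzero
  have h1 := KaehlerDifferential.tensorKaehlerEquivOfFormallyEtale_symm_D_algebraMap k k[X] L X
  rw [hzero, map_zero] at h1
  have h2 := congrArg (LinearMap.lTensor L
    (KaehlerDifferential.polynomialEquiv k).toLinearMap) h1
  have h3 := congrArg (TensorProduct.rid k[X] L) h2
  rw [map_zero, map_zero, LinearMap.lTensor_tmul, TensorProduct.rid_tmul] at h3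
  simp at h3

/-- If `k[X]` embeds into a finitely generated algebra over a field `k` of characteristic zero, then
the image of `X` has a nonzero differential in some field over the algebra. -/
lemma exists_field_D_ne_zero {k A : Type} [Field k] [CharZero k] [CommRing A]
    [Algebra k A] [Algebra.FiniteType k A] [Algebra k[X] A] [IsScalarTower k k[X] A]
    (hinj : Function.Injective (algebraMap k[X] A)) :
    ∃ (L : Type) (_ : Field L) (_ : Algebra k L) (ψ : A →ₐ[k] L),
      KaehlerDifferential.D k L (ψ (algebraMap k[X] A X)) ≠ 0 := by
  let K := FractionRing k[X]
  have : Algebra.FiniteType k[X] A := .of_restrictScalars_finiteType k k[X] A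
  have : Algebra.FiniteType K (K ⊗[k[X]] A) := inferInstance
  -- The generic fibre of `Spec A` over the affine line is nonempty: `K` is flat over `k[X]`, so `K`
  -- still embeds.
  have : Nontrivial (K ⊗[k[X]] A) := by
    have h1 : Function.Injective
        (LinearMap.lTensor K (Algebra.linearMap k[X] A)) :=
      Module.Flat.lTensor_preserves_injective_linearMap _ hinj
    have h2 : Nontrivial (K ⊗[k[X]] k[X]) :=
      (TensorProduct.rid k[X] K).symm.injective.nontrivial
    exact h1.nontrivial
  obtain ⟨mx, hmx⟩ := Ideal.exists_maximal (K ⊗[k[X]] A)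
  let L := (K ⊗[k[X]] A) ⧸ mx
  let : Field L := Ideal.Quotient.field mx
  have : Algebra.FiniteType K L := inferInstance
  -- Zariski's lemma. In characteristic zero the finite extension `L / K` is separable, so `k[X] → K
  -- → L` is formally étale.
  have : Module.Finite K L := finite_of_finite_type_of_isJacobsonRing K L
  have : CharZero K := charZero_of_injective_algebraMap
    (IsFractionRing.injective k[X] K)
  have : Algebra.FormallyEtale k[X] K := .of_isLocalization (nonZeroDivisors k[X])
  have : Algebra.FormallyEtale K L := .of_isSeparable K L
  have : Algebra.FormallyEtale k[X] L := .comp k[X] K L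
  have : IsScalarTower k k[X] L := inferInstance
  let ψ : A →ₐ[k] L := (Ideal.Quotient.mkₐ k mx).comp
      ((Algebra.TensorProduct.includeRight : A →ₐ[k[X]] K ⊗[k[X]] A).restrictScalars k)
  refine ⟨L, inferInstance, inferInstance, ψ, ?_⟩
  have hψ : ψ (algebraMap k[X] A X) = algebraMap k[X] L X := by
    change Ideal.Quotient.mk mx ((Algebra.TensorProduct.includeRight : A →ₐ[k[X]] K ⊗[k[X]] A)
      (algebraMap k[X] A X)) = _
    rw [AlgHom.commutes]
    rfl
  rw [hψ]
  exact D_algebraMap_X_ne_zero k L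

/-- Some nonzero polynomial in `f` lies in the ideal of the logarithmic partial derivatives:
`f` has finitely many critical values on the torus. -/
theorem exists_aeval_mem_span_eulerDeriv {n : ℕ} (f : LaurentPoly ℂ n) :
    ∃ P : ℂ[X], P ≠ 0 ∧ aeval f P ∈ Ideal.span (Set.range fun i => eulerDeriv i f) := by
  by_contra! hcon
  set J := Ideal.span (Set.range fun i => eulerDeriv i f) with hJ
  let fA : LaurentPoly ℂ n ⧸ J := Ideal.Quotient.mk J f
  let : Algebra ℂ[X] (LaurentPoly ℂ n ⧸ J) := (aeval fA).toAlgebra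
  have hmap : ∀ P : ℂ[X], algebraMap ℂ[X] (LaurentPoly ℂ n ⧸ J) P =
      Ideal.Quotient.mkₐ ℂ J (aeval f P) := by
    intro P
    change aeval fA P = Ideal.Quotient.mkₐ ℂ J (aeval f P)
    rw [← aeval_algHom_apply]
    rfl
  have : IsScalarTower ℂ ℂ[X] (LaurentPoly ℂ n ⧸ J) := IsScalarTower.of_algebraMap_eq fun c => by
    change _ = aeval fA (C c)
    rw [aeval_C]
  have hinj : Function.Injective (algebraMap ℂ[X] (LaurentPoly ℂ n ⧸ J)) := by
    rw [injective_iff_map_eq_zero]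
    intro P hP
    by_contra hne
    rw [hmap] at hP
    exact hcon P hne (Ideal.Quotient.eq_zero_iff_mem.1 hP)
  -- With `ℂ[X]` embedded in the quotient by `X ↦ f`, the differential of `f` would survive in `L`.
  -- But it is a combination of the images of the `xᵢ ∂f/∂xᵢ`, which are zero modulo `J`.
  obtain ⟨L, _, _, ψ, hψ⟩ := exists_field_D_ne_zero hinj
  apply hψ
  rw [hmap, aeval_X, ← AlgHom.comp_apply, derivation_algHom_apply]
  refine Finset.sum_eq_zero fun i _ => ?_
  have : (Ideal.Quotient.mkₐ ℂ J) (eulerDeriv i f) = 0 :=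
    Ideal.Quotient.eq_zero_iff_mem.2 (Ideal.subset_span ⟨i, rfl⟩)
  rw [AlgHom.comp_apply, this, map_zero, zero_smul]

end LaurentPencil

/-! ### The algebraic residue form -/

namespace LaurentPencil
open Polynomial

lemma monom_add {n : ℕ} {x : Fin n → ℂ} (hx : ∀ i, x i ≠ 0) (a b : Fin n → ℤ) :
    monom (a + b) x = monom a x * monom b x := by
  simp [monom, zpow_add₀ (hx _), Finset.prod_mul_distrib]

/-- Evaluation of Laurent polynomials at a point of the torus, as an algebra homomorphism. -/
def evalHom {n : ℕ} (x : Fin n → ℂ) (hx : ∀ i, x i ≠ 0) : LaurentPoly ℂ n →ₐ[ℂ] ℂ :=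
  AddMonoidAlgebra.lift ℂ ℂ (Fin n → ℤ)
    { toFun := fun a => monom a.toAdd x
      map_one' := by simp [monom]
      map_mul' := fun a b => monom_add hx _ _ }

lemma evalHom_apply {n : ℕ} (x : Fin n → ℂ) (hx : ∀ i, x i ≠ 0) (f : LaurentPoly ℂ n) :
    evalHom x hx f = eval f x := by
  simp [evalHom, AddMonoidAlgebra.lift_apply, eval]

lemma eval_pow {n : ℕ} (f : LaurentPoly ℂ n) {x : Fin n → ℂ} (hx : ∀ i, x i ≠ 0) (k : ℕ) :
    eval (f ^ k) x = eval f x ^ k := by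
  simp [← evalHom_apply x hx]

lemma hasFDerivAt_monom {n : ℕ} {x : Fin n → ℂ} (hx : ∀ i, x i ≠ 0) (a : Fin n → ℤ) :
    HasFDerivAt (monom a) (∑ i, ((a i : ℂ) * monom a x * (x i)⁻¹) •
      (ContinuousLinearMap.proj i : (Fin n → ℂ) →L[ℂ] ℂ)) x := by
  have h := HasFDerivAt.finsetProd (u := Finset.univ) (g := fun i (y : Fin n → ℂ) => y i ^ a i) (x := x)
    (g' := fun i => ((a i : ℂ) * x i ^ (a i - 1)) •
      (ContinuousLinearMap.proj i : (Fin n → ℂ) →L[ℂ] ℂ))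
    (fun i _ => HasDerivAt.comp_hasFDerivAt (h₂ := fun z : ℂ => z ^ a i) x
      (hasDerivAt_zpow (a i) (x i) (Or.inl (hx i)))
      (ContinuousLinearMap.proj i : (Fin n → ℂ) →L[ℂ] ℂ).hasFDerivAt)
  refine h.congr_fderiv (Finset.sum_congr rfl fun i _ => ?_)
  rw [smul_smul]
  congr 1
  rw [monom, ← Finset.mul_prod_erase Finset.univ _ (Finset.mem_univ i), zpow_sub_one₀ (hx i)]
  ring

lemma hasFDerivAt_eval {n : ℕ} (f : LaurentPoly ℂ n) {x : Fin n → ℂ} (hx : ∀ i, x i ≠ 0) :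
    HasFDerivAt (eval f) (∑ i, (eval (eulerDeriv i f) x * (x i)⁻¹) •
      (ContinuousLinearMap.proj i : (Fin n → ℂ) →L[ℂ] ℂ)) x := by
  have h : HasFDerivAt (eval f) (∑ a ∈ f.coeff.support, f.coeff a •
      ∑ i, ((a i : ℂ) * monom a x * (x i)⁻¹) •
      (ContinuousLinearMap.proj i : (Fin n → ℂ) →L[ℂ] ℂ)) x := by
    unfold eval Finsupp.sum
    refine HasFDerivAt.fun_sum fun a _ => ?_
    exact (hasFDerivAt_monom hx a).const_mul _
  refine h.congr_fderiv ?_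
  simp only [Finset.smul_sum]
  rw [Finset.sum_comm]
  refine Finset.sum_congr rfl fun i _ => ?_
  have h : eval (eulerDeriv i f) x = ∑ a ∈ f.coeff.support, f.coeff a * ((a i : ℂ) * monom a x) := by
    rw [← evalHom_apply x hx, eulerDeriv, Finsupp.sum, map_sum]
    refine Finset.sum_congr rfl fun a _ => ?_
    rw [evalHom_apply]
    simp only [eval, AddMonoidAlgebra.coeff_single, zero_mul, Finsupp.sum_single_index]
    ring
  ext v
  simp only [h, sum_apply, smul_apply, smul_eq_mul, Finset.sum_mul]
  refine Finset.sum_congr rfl fun a _ => ?_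
  ring

/-- `α ∧ ⋀_{k ≠ i} dlog x_k = (-1)ⁱ α(x_i ∂_i) dlog x₁ ∧ … ∧ dlog xₙ`. -/
lemma wedgeCovector_dlogOmit (m : ℕ) (i : Fin (m + 1)) {x : Fin (m + 1) → ℂ} (hx : ∀ k, x k ≠ 0)
    (α : (Fin (m + 1) → ℂ) →ₗ[ℂ] ℂ) :
    wedgeCovector α (dlogOmit m i x) =
      ((-1) ^ (i : ℕ) * (α (Pi.single i 1) * x i)) • dlogVol (m + 1) x := by
  ext v
  let M : Matrix (Fin (m + 1)) (Fin (m + 1)) ℂ := fun j k => (x k)⁻¹ * v j k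
  have hα : ∀ j, α (v j) = ∑ k, (α (Pi.single k 1) * x k) • M j k := by
    intro j
    rw [LinearMap.pi_apply_eq_sum_univ α]
    refine Finset.sum_congr rfl fun k _ => ?_
    simp only [M, smul_eq_mul]
    have : α (fun j ↦ if k = j then 1 else 0) = α (Pi.single k 1) := by
      congr 1; ext j; simp [Pi.single_apply, eq_comm]
    rw [this]
    field_simp [hx k]
  have hdet : dlogVol (m + 1) x v = M.det := rfl
  -- The column `α(v_j)` is a combination of the columns of `M`, so putting it in place of column
  -- `i` multiplies the determinant by the coefficient number `i`. The Laplace expansion along that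
  -- column is the wedge product.
  have hcol := Matrix.det_updateCol_sum M i fun k => α (Pi.single k 1) * x k
  simp only [← hα] at hcol
  rw [Matrix.det_succ_column _ i] at hcol
  rw [AlternatingMap.smul_apply, hdet, mul_smul, ← hcol, Finset.smul_sum, wedgeCovector,
    AlternatingMap.alternatizeUncurryFin_apply]
  refine Finset.sum_congr rfl fun j _ => ?_
  have hsub : dlogOmit m i x (j.removeNth v) =
      ((M.updateCol i fun k => α (v k)).submatrix j.succAbove i.succAbove).det := by
    change Matrix.det _ = _
    congr 1
    ext p q
    rw [Matrix.submatrix_apply, Matrix.updateCol_ne (Fin.succAbove_ne i q)]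
    rfl
  simp only [LinearMap.smulRight_apply, AlternatingMap.smul_apply, hsub, Matrix.updateCol_self,
    smul_eq_mul, zsmul_eq_mul]
  push_cast
  rw [pow_add]
  have : ((-1 : ℂ) ^ (i : ℕ)) * (-1) ^ (i : ℕ) = 1 := by rw [← mul_pow]; simp
  generalize ((M.updateCol i fun k => α (v k)).submatrix j.succAbove i.succAbove).det = δ
  linear_combination (-(-1 : ℂ) ^ (j : ℕ) * (α (v j) * δ)) * this

lemma wedgeCovector_sum {n k : ℕ} {ι : Type*} (s : Finset ι) (α : (Fin n → ℂ) →ₗ[ℂ] ℂ) (c : ι → ℂ)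
    (η : ι → (Fin n → ℂ) [⋀^Fin k]→ₗ[ℂ] ℂ) :
    wedgeCovector α (∑ i ∈ s, c i • η i) = ∑ i ∈ s, c i • wedgeCovector α (η i) := by
  have hadd : ∀ η₁ η₂ : (Fin n → ℂ) [⋀^Fin k]→ₗ[ℂ] ℂ,
      wedgeCovector α (η₁ + η₂) = wedgeCovector α η₁ + wedgeCovector α η₂ := by
    intro η₁ η₂
    ext v
    simp [wedgeCovector, AlternatingMap.alternatizeUncurryFin_apply, Finset.sum_add_distrib]
  have hsmul : ∀ (c : ℂ) (η : (Fin n → ℂ) [⋀^Fin k]→ₗ[ℂ] ℂ),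
      wedgeCovector α (c • η) = c • wedgeCovector α η := by
    intro c η
    ext v
    simp [wedgeCovector, AlternatingMap.alternatizeUncurryFin_apply, Finset.mul_sum]
    refine Finset.sum_congr rfl fun j _ => ?_
    ring
  classical
  induction s using Finset.induction_on with
  | empty =>
    ext v
    simp [wedgeCovector, AlternatingMap.alternatizeUncurryFin_apply]
  | insert i s hi ih => rw [Finset.sum_insert hi, Finset.sum_insert hi, hadd, hsmul, ih]

/-- There is a relative form that is the residue form on `Y_t` for all small `t ≠ 0`. -/
theorem exists_residueForm {m : ℕ} (f : LaurentPoly ℂ (m + 1)) :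
    ∃ ω : RelativeForm m, ∃ ε : ℝ, 0 < ε ∧ ∀ t : ℂ, t ≠ 0 → ‖t‖ < ε → IsResidueAt f ω t := by
  obtain ⟨P, hP, hmem⟩ := exists_aeval_mem_span_eulerDeriv f
  obtain ⟨b, hb⟩ := (Ideal.mem_span_range_iff_exists_fun).1 hmem
  have hpi : (2 * (Real.pi : ℂ) * Complex.I) ^ m ≠ 0 := pow_ne_zero _ Complex.two_pi_I_ne_zero
  -- The `i`-th coefficient is `(-1)^{i+1} bᵢ / ((2πi)^m t P(1/t))`, cleared of negative powers of
  -- `t` by `t^d P(1/t) = P.reverse(t)` with `d` the degree of `P`. The sign absorbs the `(-1)^i` of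
  -- `wedgeCovector_dlogOmit` and the minus in `dF = -t df`.
  let ω : RelativeForm m :=
    { den := C ((2 * (Real.pi : ℂ) * Complex.I) ^ m) * (X * P.reverse)
      den_ne_zero := by
        simp [hP, Real.pi_ne_zero]
      num := fun i => AddMonoidAlgebra.ofCoeff
        ((b i).coeff.mapRange (fun c => C ((-1) ^ ((i : ℕ) + 1) * c) * X ^ P.natDegree) (by simp)) }
  -- The constant term of the reversed polynomial is the leading coefficient of `P`; this is why
  -- every small `t ≠ 0` is admissible.
  have hrev : P.reverse.eval 0 ≠ 0 := by
    rw [← coeff_zero_eq_eval_zero, coeff_zero_reverse]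
    simpa using hP
  obtain ⟨ε, hε, hball⟩ := Metric.eventually_nhds_iff.1
    ((P.reverse.continuous.continuousAt (x := 0)).eventually_ne hrev)
  refine ⟨ω, ε, hε, fun t ht htε => ?_⟩
  have hrt : P.reverse.eval t ≠ 0 := hball (by simpa using htε)
  rintro x ⟨hx, hxt⟩
  have hfx : eval f x = t⁻¹ := by
    simp only [pencilFun] at hxt
    field_simp
    linear_combination -hxt
  have hsum : ∑ i, eval (b i) x * eval (eulerDeriv i f) x = P.eval t⁻¹ := by
    have := congrArg (evalHom x hx) hb
    rw [map_sum, ← aeval_algHom_apply, evalHom_apply, hfx] at this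
    simpa only [map_mul, evalHom_apply, coe_aeval_eq_eval] using this
  have hrevt : P.reverse.eval t = t ^ P.natDegree * P.eval t⁻¹ := by
    have : Invertible t⁻¹ := invertibleOfNonzero (inv_ne_zero ht)
    have h := eval₂_reverse_mul_pow (RingHom.id ℂ) t⁻¹ P
    rw [invOf_eq_inv, inv_inv] at h
    rw [← eval₂_id, ← eval₂_id, ← h, inv_pow]
    field_simp
  have hnum : ∀ i, ((ω.num i).coeff.sum fun a p => p.eval t * monom a x) =
      (-1) ^ ((i : ℕ) + 1) * t ^ P.natDegree * LaurentPencil.eval (b i) x := by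
    intro i
    simp only [ω]
    rw [Finsupp.sum_mapRange_index (by simp), LaurentPencil.eval, Finsupp.mul_sum]
    refine Finsupp.sum_congr fun a _ => ?_
    simp only [eval_mul, eval_C, Polynomial.eval_pow, eval_X]
    ring
  have hden : ω.den.eval t = (2 * (Real.pi : ℂ) * Complex.I) ^ m * (t * P.reverse.eval t) := by
    simp [ω]
  have hF : HasFDerivAt (pencilFun f t) (-(t • ∑ i, (LaurentPencil.eval (eulerDeriv i f) x *
      (x i)⁻¹) • (ContinuousLinearMap.proj i : (Fin (m + 1) → ℂ) →L[ℂ] ℂ))) x :=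
    ((hasFDerivAt_eval f hx).const_mul t).const_sub 1
  have hFi : ∀ i, fderiv ℂ (pencilFun f t) x (Pi.single i 1) * x i =
      -(t * LaurentPencil.eval (eulerDeriv i f) x) := by
    intro i
    rw [hF.fderiv]
    simp [Pi.single_apply, hx i, mul_assoc]
  simp only [RelativeForm.at, wedgeCovector_sum, wedgeCovector_dlogOmit m _ hx,
    ContinuousLinearMap.coe_coe, hFi, hnum, hden, smul_smul, ← Finset.sum_smul]
  congr 1
  have hterm : ∀ i : Fin (m + 1), (-1) ^ ((i : ℕ) + 1) * t ^ P.natDegree *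
      LaurentPencil.eval (b i) x / ((2 * (Real.pi : ℂ) * Complex.I) ^ m * (t * P.reverse.eval t)) *
      ((-1) ^ (i : ℕ) * -(t * LaurentPencil.eval (eulerDeriv i f) x)) =
      t ^ P.natDegree * t / ((2 * (Real.pi : ℂ) * Complex.I) ^ m * (t * P.reverse.eval t)) *
      (LaurentPencil.eval (b i) x * LaurentPencil.eval (eulerDeriv i f) x) := by
    intro i
    have : ((-1 : ℂ) ^ (i : ℕ)) * (-1) ^ (i : ℕ) = 1 := by rw [← mul_pow]; simp
    rw [pow_succ]
    linear_combination (t ^ P.natDegree * t /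
      ((2 * (Real.pi : ℂ) * Complex.I) ^ m * (t * P.reverse.eval t)) *
      (LaurentPencil.eval (b i) x * LaurentPencil.eval (eulerDeriv i f) x)) * this
  rw [Finset.sum_congr rfl fun i _ => hterm i, ← Finset.mul_sum, hsum]
  rw [hrevt] at hrt ⊢
  have h1 : P.eval t⁻¹ ≠ 0 := right_ne_zero_of_mul hrt
  generalize P.eval t⁻¹ = p at h1
  field_simp

end LaurentPencil

/-! ### Solving `s = w exp(ℓ(s, θ))` in the unit disc -/

namespace LaurentPencil
open Metric Set Filter Topology

/-- Hypotheses on `ℓ` under which `s = w * exp (ℓ (s, θ))` can be solved for `s` in the unit disc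
when `‖w‖ < 1 / 2`; `ℓ'` is the derivative in `s`. -/
structure IsInvertibleExponent {E : Type*} [NormedAddCommGroup E] [NormedSpace ℝ E]
    (ℓ ℓ' : ℂ × E → ℂ) : Prop where
  contDiffOn : ContDiffOn ℝ (⊤ : ℕ∞) ℓ (ball 0 1 ×ˢ univ)
  hasDerivAt : ∀ s ∈ ball (0 : ℂ) 1, ∀ θ, HasDerivAt (fun s => ℓ (s, θ)) (ℓ' (s, θ)) s
  norm_deriv_le : ∀ s ∈ ball (0 : ℂ) 1, ∀ θ, ‖ℓ' (s, θ)‖ ≤ 1 / 3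
  norm_exp_le : ∀ s ∈ ball (0 : ℂ) 1, ∀ θ, ‖Complex.exp (ℓ (s, θ))‖ ≤ 5 / 4

namespace IsInvertibleExponent

variable {E : Type*} [NormedAddCommGroup E] [NormedSpace ℝ E] {ℓ ℓ' : ℂ × E → ℂ}

lemma norm_exp_sub_le (h : IsInvertibleExponent ℓ ℓ') {s₁ s₂ : ℂ} (h₁ : s₁ ∈ ball (0 : ℂ) 1)
    (h₂ : s₂ ∈ ball (0 : ℂ) 1) (θ : E) :
    ‖Complex.exp (ℓ (s₁, θ)) - Complex.exp (ℓ (s₂, θ))‖ ≤ 5 / 12 * ‖s₁ - s₂‖ := by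
  refine (convex_ball (0 : ℂ) 1).norm_image_sub_le_of_norm_hasDerivWithin_le
    (f := fun s => Complex.exp (ℓ (s, θ)))
    (f' := fun s => Complex.exp (ℓ (s, θ)) * ℓ' (s, θ)) (fun s hs => ?_) (fun s hs => ?_) h₂ h₁
  · exact (h.hasDerivAt s hs θ).cexp.hasDerivWithinAt
  · rw [norm_mul]
    calc _ ≤ 5 / 4 * (1 / 3 : ℝ) := mul_le_mul (h.norm_exp_le s hs θ) (h.norm_deriv_le s hs θ)
          (norm_nonneg _) (by norm_num)
      _ = 5 / 12 := by norm_num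

/-- The right-hand side is Lipschitz in `s` with constant `1/2 · 5/12 < 1`, so two fixed points
coincide. -/
lemma eq_of_eq (h : IsInvertibleExponent ℓ ℓ') {w s₁ s₂ : ℂ} {θ : E} (hw : ‖w‖ < 1 / 2)
    (h₁ : s₁ ∈ ball (0 : ℂ) 1) (h₂ : s₂ ∈ ball (0 : ℂ) 1)
    (e₁ : s₁ = w * Complex.exp (ℓ (s₁, θ))) (e₂ : s₂ = w * Complex.exp (ℓ (s₂, θ))) :
    s₁ = s₂ := by
  have h3 := h.norm_exp_sub_le h₁ h₂ θ
  have h4 : ‖s₁ - s₂‖ = ‖w‖ * ‖Complex.exp (ℓ (s₁, θ)) - Complex.exp (ℓ (s₂, θ))‖ := by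
    rw [← norm_mul, mul_sub, ← e₁, ← e₂]
  have h5 : ‖s₁ - s₂‖ ≤ 1 / 2 * (5 / 12 * ‖s₁ - s₂‖) := by
    conv_lhs => rw [h4]
    exact mul_le_mul hw.le h3 (norm_nonneg _) (by norm_num)
  have h6 : ‖s₁ - s₂‖ ≤ 0 := by linarith
  exact sub_eq_zero.1 (norm_le_zero_iff.1 h6)

lemma exists_solution (h : IsInvertibleExponent ℓ ℓ') {w : ℂ} (hw : ‖w‖ < 1 / 2) (θ : E) :
    ∃ s ∈ ball (0 : ℂ) 1, s = w * Complex.exp (ℓ (s, θ)) := by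
  -- The contraction principle needs a complete set inside the open disc; radius `3/4` works because
  -- `1/2 · 5/4 ≤ 3/4`.
  have hsub : closedBall (0 : ℂ) (3 / 4) ⊆ ball 0 1 := closedBall_subset_ball (by norm_num)
  have hmaps : MapsTo (fun s => w * Complex.exp (ℓ (s, θ))) (closedBall (0 : ℂ) (3 / 4))
      (closedBall 0 (3 / 4)) := by
    intro s hs
    rw [mem_closedBall_zero_iff, norm_mul]
    calc _ ≤ 1 / 2 * (5 / 4 : ℝ) := mul_le_mul hw.le (h.norm_exp_le s (hsub hs) θ)
          (norm_nonneg _) (by norm_num)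
      _ ≤ 3 / 4 := by norm_num
  have hcontr : ContractingWith (1 / 2) (hmaps.restrict _ _ _) := by
    refine ⟨by norm_num, LipschitzWith.of_dist_le_mul fun s₁ s₂ => ?_⟩
    rw [Subtype.dist_eq, Subtype.dist_eq, dist_eq_norm, dist_eq_norm]
    simp only [MapsTo.val_restrict_apply]
    rw [← mul_sub, norm_mul]
    calc _ ≤ 1 / 2 * (5 / 12 * ‖(s₁ : ℂ) - s₂‖) :=
          mul_le_mul hw.le (h.norm_exp_sub_le (hsub s₁.2) (hsub s₂.2) θ)
          (norm_nonneg _) (by norm_num)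
      _ ≤ 1 / 2 * ‖(s₁ : ℂ) - s₂‖ := by nlinarith [norm_nonneg ((s₁ : ℂ) - s₂)]
      _ = _ := by simp
  obtain ⟨s, hs, hfix, -⟩ := hcontr.exists_fixedPoint' (isClosed_closedBall.isComplete) hmaps
    (x := 0) (mem_closedBall_self (by norm_num)) (edist_ne_top _ _)
  exact ⟨s, hsub hs, hfix.symm⟩

open Classical in
/-- The solution `s` in the unit disc of `s = w * exp (ℓ (s, θ))`. -/
def solution (ℓ : ℂ × E → ℂ) (p : ℂ × E) : ℂ :=
  if hs : ∃ s ∈ ball (0 : ℂ) 1, s = p.1 * Complex.exp (ℓ (s, p.2)) then hs.choose else 0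

lemma solution_mem (h : IsInvertibleExponent ℓ ℓ') {w : ℂ} (hw : ‖w‖ < 1 / 2) (θ : E) :
    solution ℓ (w, θ) ∈ ball (0 : ℂ) 1 := by
  rw [solution, dif_pos (h.exists_solution hw θ)]
  exact (h.exists_solution hw θ).choose_spec.1

lemma solution_eq (h : IsInvertibleExponent ℓ ℓ') {w : ℂ} (hw : ‖w‖ < 1 / 2) (θ : E) :
    solution ℓ (w, θ) = w * Complex.exp (ℓ (solution ℓ (w, θ), θ)) := by
  rw [solution, dif_pos (h.exists_solution hw θ)]
  exact (h.exists_solution hw θ).choose_spec.2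

lemma solution_ne_zero (h : IsInvertibleExponent ℓ ℓ') {w : ℂ} (hw : ‖w‖ < 1 / 2) (hw0 : w ≠ 0)
    (θ : E) : solution ℓ (w, θ) ≠ 0 := by
  rw [h.solution_eq hw θ]
  exact mul_ne_zero hw0 (Complex.exp_ne_zero _)

lemma one_sub_ne_zero (h : IsInvertibleExponent ℓ ℓ') {s : ℂ} (hs : s ∈ ball (0 : ℂ) 1) (θ : E) :
    2 / 3 ≤ ‖1 - s * ℓ' (s, θ)‖ ∧ 1 - s * ℓ' (s, θ) ≠ 0 := by
  have h1 : ‖s * ℓ' (s, θ)‖ ≤ 1 / 3 := by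
    rw [norm_mul]
    calc _ ≤ 1 * (1 / 3 : ℝ) := mul_le_mul (mem_ball_zero_iff.1 hs).le
          (h.norm_deriv_le s hs θ) (norm_nonneg _) (by norm_num)
      _ = _ := by norm_num
  have h2 := norm_sub_norm_le (1 : ℂ) (s * ℓ' (s, θ))
  rw [norm_one] at h2
  have h3 : 2 / 3 ≤ ‖1 - s * ℓ' (s, θ)‖ := by linarith
  exact ⟨h3, fun h0 => by rw [h0, norm_zero] at h3; norm_num at h3⟩

/-- The implicit function theorem is applied over `ℝ`, since `θ` is a real variable. The partial
derivative in `s` is multiplication by `1 - s ℓ'`, which is nonzero, and uniqueness of small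
solutions identifies the implicit function with `solution`. -/
lemma contDiffAt_solution [CompleteSpace E] (h : IsInvertibleExponent ℓ ℓ') {w : ℂ}
    (hw : ‖w‖ < 1 / 2) (θ : E) : ContDiffAt ℝ (⊤ : ℕ∞) (solution ℓ) (w, θ) := by
  set s₀ := solution ℓ (w, θ) with hs₀
  have hs₀m : s₀ ∈ ball (0 : ℂ) 1 := h.solution_mem hw θ
  have hs₀e : s₀ = w * Complex.exp (ℓ (s₀, θ)) := h.solution_eq hw θ
  let u : (ℂ × E) × ℂ := ((w, θ), s₀)
  let f : (ℂ × E) × ℂ → ℂ := fun q => q.2 - q.1.1 * Complex.exp (ℓ (q.2, q.1.2))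
  have hℓ : ContDiffAt ℝ (⊤ : ℕ∞) ℓ (s₀, θ) :=
    h.contDiffOn.contDiffAt ((isOpen_ball.prod isOpen_univ).mem_nhds ⟨hs₀m, mem_univ _⟩)
  have hf : ContDiffAt ℝ (⊤ : ℕ∞) f u := by
    have h1 : ContDiffAt ℝ (⊤ : ℕ∞) (fun q : (ℂ × E) × ℂ => ℓ (q.2, q.1.2)) u :=
      ContDiffAt.comp (g := ℓ) (f := fun q : (ℂ × E) × ℂ => (q.2, q.1.2)) u hℓ (by fun_prop)
    have h2 : ContDiffAt ℝ (⊤ : ℕ∞) (fun q : (ℂ × E) × ℂ => Complex.exp (ℓ (q.2, q.1.2))) u :=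
      h1.cexp
    exact contDiffAt_snd.sub ((contDiffAt_fst.comp u contDiffAt_fst).mul h2)
  have hfu : f u = 0 := by
    simp only [f, u]
    rw [← hs₀e, sub_self]
  have hder : HasDerivAt (fun s => f ((w, θ), s)) (1 - s₀ * ℓ' (s₀, θ)) s₀ := by
    have := (hasDerivAt_id s₀).sub (((h.hasDerivAt s₀ hs₀m θ).cexp).const_mul w)
    refine this.congr_deriv ?_
    rw [← mul_assoc, ← hs₀e]
  have hinv : (fderiv ℝ f u ∘L .inr ℝ (ℂ × E) ℂ).IsInvertible := by
    have h1 : HasFDerivAt (fun s => f ((w, θ), s)) (fderiv ℝ f u ∘L .inr ℝ (ℂ × E) ℂ) s₀ := by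
      have := (hf.differentiableAt (by simp)).hasFDerivAt.comp s₀
        (hasFDerivAt_prodMk_right (𝕜 := ℝ) (w, θ) s₀)
      exact this
    refine ⟨((ContinuousLinearEquiv.unitsEquivAut ℂ)
      (Units.mk0 _ (h.one_sub_ne_zero hs₀m θ).2)).restrictScalars ℝ, ?_⟩
    rw [h1.unique (hder.hasFDerivAt.restrictScalars ℝ)]
    ext z
    all_goals simp
  have hne : ((⊤ : ℕ∞) : WithTop ℕ∞) ≠ 0 := by simp
  have hcd := hf.contDiffAt_implicitFunction hne hinv
  refine hcd.congr_of_eventuallyEq ?_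
  have hball : ∀ᶠ q in 𝓝 u.1, hf.implicitFunction hne hinv q ∈ ball (0 : ℂ) 1 := by
    refine hcd.continuousAt.eventually_mem (isOpen_ball.mem_nhds ?_)
    rw [hf.implicitFunction_apply_self hne hinv]
    exact hs₀m
  have hw' : ∀ᶠ q : ℂ × E in 𝓝 u.1, ‖q.1‖ < 1 / 2 :=
    (continuous_fst.norm.continuousAt (x := u.1)).eventually_lt continuousAt_const hw
  filter_upwards [hball, hw', hf.eventually_apply_implicitFunction hne hinv] with q h1 h2 h3
  rw [hfu] at h3
  exact h.eq_of_eq h2 (h.solution_mem h2 q.2) h1 (h.solution_eq h2 q.2) (sub_eq_zero.1 h3)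

/-- For fixed `θ` the solution is a local inverse of the holomorphic map `s ↦ s exp(-ℓ(s, θ))`,
hence complex differentiable in `w`. -/
lemma hasDerivAt_solution [CompleteSpace E] (h : IsInvertibleExponent ℓ ℓ') {w : ℂ}
    (hw : ‖w‖ < 1 / 2) (θ : E) :
    HasDerivAt (fun w => solution ℓ (w, θ)) (Complex.exp (ℓ (solution ℓ (w, θ), θ)) /
      (1 - solution ℓ (w, θ) * ℓ' (solution ℓ (w, θ), θ))) w := by
  set s₀ := solution ℓ (w, θ) with hs₀
  have hs₀m : s₀ ∈ ball (0 : ℂ) 1 := h.solution_mem hw θ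
  have hder : HasDerivAt (fun s => s * Complex.exp (-ℓ (s, θ)))
      (Complex.exp (-ℓ (s₀, θ)) * (1 - s₀ * ℓ' (s₀, θ))) s₀ := by
    refine ((hasDerivAt_id s₀).mul (h.hasDerivAt s₀ hs₀m θ).neg.cexp).congr_deriv ?_
    simp
    ring
  have hcont : ContinuousAt (fun w => solution ℓ (w, θ)) w :=
    ContinuousAt.comp (f := fun w => (w, θ)) (h.contDiffAt_solution hw θ).continuousAt (by fun_prop)
  have := HasDerivAt.of_local_left_inverse hcont hder
    (mul_ne_zero (Complex.exp_ne_zero _) (h.one_sub_ne_zero hs₀m θ).2) ?_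
  · refine this.congr_deriv ?_
    rw [mul_inv, Complex.exp_neg, inv_inv, div_eq_mul_inv]
  · have hw' : ∀ᶠ q : ℂ in 𝓝 w, ‖q‖ < 1 / 2 :=
      (continuous_norm.continuousAt (x := w)).eventually_lt continuousAt_const hw
    filter_upwards [hw'] with q hq
    conv_lhs => rw [h.solution_eq hq θ]
    rw [mul_assoc, ← h.solution_eq hq θ, ← Complex.exp_add, add_neg_cancel, Complex.exp_zero, mul_one]

end IsInvertibleExponent

end LaurentPencil

/-! ### A dominant term of `f` on a torus -/

namespace LaurentPencil
open Metric Set Filter Topology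

/-- Otherwise the polytope lies in the half-space `y₀ ≥ 0`, which has `0` on its boundary. This is
all that is needed of the hypothesis on the Newton polytope. -/
lemma exists_neg_exponent {m : ℕ} (f : LaurentPoly ℂ (m + 1))
    (hf : (0 : Fin (m + 1) → ℝ) ∈ interior (newtonPolytope f)) :
    ∃ a ∈ f.coeff.support, a 0 < 0 := by
  by_contra! hcon
  have hsub : newtonPolytope f ⊆ {y | 0 ≤ y 0} := by
    refine convexHull_min ?_ (convex_halfSpace_ge (IsLinearMap.mk (by simp) (by simp)) 0)
    rintro _ ⟨a, ha, rfl⟩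
    exact Int.cast_nonneg (R := ℝ) (hcon a ha)
  obtain ⟨ε, hε, hball⟩ := Metric.isOpen_iff.1 isOpen_interior 0 hf
  have hmem : (Pi.single 0 (-(ε / 2)) : Fin (m + 1) → ℝ) ∈ ball (0 : Fin (m + 1) → ℝ) ε := by
    rw [mem_ball_zero_iff, Pi.norm_single, Real.norm_eq_abs, abs_neg, abs_of_pos (by positivity)]
    linarith
  have := hsub (interior_subset (hball hmem))
  simp at this
  linarith

/-- A term `c_v x^v` of `f`, of least degree `-N < 0` in the variable `x₀`, that dominates the
other terms on the torus of radii `r`. -/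
structure DominantTerm {m : ℕ} (f : LaurentPoly ℂ (m + 1)) where
  v : Fin (m + 1) → ℤ
  N : ℕ
  r : Fin (m + 1) → ℝ
  v_mem : v ∈ f.coeff.support
  v_zero : v 0 = -(N : ℤ)
  N_pos : 0 < N
  le_of_mem : ∀ a ∈ f.coeff.support, v 0 ≤ a 0
  r_pos : ∀ i, 0 < r i
  bound : ∑ a ∈ f.coeff.support.erase v, ‖f.coeff a‖ * (1 + ((a 0 - v 0).toNat : ℝ)) * ∏ i, r i ^ a i
    ≤ 1 / 4 * (‖f.coeff v‖ * ∏ i, r i ^ v i)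

/-- Some vertex of the lowest face is separated strictly from the other exponents by an
integral functional. -/
lemma exists_separating {m : ℕ} (s : Finset (Fin (m + 1) → ℤ)) (hs : s.Nonempty) :
    ∃ v ∈ s, (∀ a ∈ s, v 0 ≤ a 0) ∧ ∃ u : Fin (m + 1) → ℤ, ∀ a ∈ s, a ≠ v →
      ∑ i, u i * a i < ∑ i, u i * v i := by
  obtain ⟨b, hb, hbmin⟩ := s.exists_min_image (fun a => a 0) hs
  -- A point of the lowest face farthest from the axis is a vertex of that face. The functional is
  -- the inner product with `v` in the last coordinates, with a large multiple of the first
  -- coordinate subtracted.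
  obtain ⟨v, hv, hvmax⟩ := (s.filter fun a => a 0 = b 0).exists_max_image
    (fun a => ∑ j : Fin m, a j.succ ^ 2) ⟨b, by simp [hb]⟩
  rw [Finset.mem_filter] at hv
  let q : (Fin (m + 1) → ℤ) → ℤ := fun a => ∑ j : Fin m, v j.succ * a j.succ
  -- Large enough that one unit of height above the lowest face outweighs any difference of values
  -- of `q`.
  let K : ℤ := 1 + ∑ a ∈ s, |q v - q a|
  refine ⟨v, hv.1, fun a ha => hv.2.trans_le (hbmin a ha), Fin.cons (-K) fun j => v j.succ,
    fun a ha hne => ?_⟩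
  simp only [Fin.sum_univ_succ, Fin.cons_zero, Fin.cons_succ]
  change -K * a 0 + q a < -K * v 0 + q v
  have hle : v 0 ≤ a 0 := hv.2.trans_le (hbmin a ha)
  rcases hle.eq_or_lt with heq | hlt
  · have h1 : ∑ j : Fin m, a j.succ ^ 2 ≤ ∑ j : Fin m, v j.succ ^ 2 :=
      hvmax a (by simp [ha, ← heq, hv.2])
    have h2 : 0 < ∑ j : Fin m, (v j.succ - a j.succ) ^ 2 := by
      refine lt_of_le_of_ne (Finset.sum_nonneg fun j _ => sq_nonneg _) fun h0 => hne ?_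
      have h0' := (Finset.sum_eq_zero_iff_of_nonneg fun j _ => sq_nonneg _).1 h0.symm
      ext i
      refine Fin.cases heq.symm (fun j => ?_) i
      have := h0' j (Finset.mem_univ j)
      rw [sq_eq_zero_iff] at this
      linarith
    have h3 : ∑ j : Fin m, (v j.succ - a j.succ) ^ 2 =
        ∑ j : Fin m, v j.succ ^ 2 + ∑ j : Fin m, a j.succ ^ 2 - 2 * q a := by
      simp only [q, Finset.mul_sum, ← Finset.sum_add_distrib, ← Finset.sum_sub_distrib]
      exact Finset.sum_congr rfl fun j _ => by ring
    have h4 : q v = ∑ j : Fin m, v j.succ ^ 2 := Finset.sum_congr rfl fun j _ => by ring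
    rw [heq]
    linarith
  · have h1 : |q v - q a| ≤ ∑ a ∈ s, |q v - q a| :=
      Finset.single_le_sum (f := fun a => |q v - q a|) (fun _ _ => abs_nonneg _) ha
    have h2 : 0 ≤ ∑ a ∈ s, |q v - q a| := Finset.sum_nonneg fun _ _ => abs_nonneg _
    have h3 := neg_abs_le (q v - q a)
    have h4 : K ≤ K * (a 0 - v 0) := by
      have : 0 ≤ K := by simp only [K]; linarith
      nlinarith
    simp only [K] at h4 ⊢
    nlinarith

theorem exists_dominantTerm {m : ℕ} (f : LaurentPoly ℂ (m + 1))
    (hf : ∃ a ∈ f.coeff.support, a 0 < 0) : Nonempty (DominantTerm f) := by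
  obtain ⟨a₀, ha₀, ha₀neg⟩ := hf
  obtain ⟨v, hv, hmin, u, hu⟩ := exists_separating f.coeff.support ⟨a₀, ha₀⟩
  have hv0 : v 0 < 0 := (hmin a₀ ha₀).trans_lt ha₀neg
  have hcv : 0 < ‖f.coeff v‖ := norm_pos_iff.2 (Finsupp.mem_support_iff.1 hv)
  set M : ℝ := ∑ a ∈ f.coeff.support.erase v, ‖f.coeff a‖ * (1 + ((a 0 - v 0).toNat : ℝ)) with hM
  have hM0 : 0 ≤ M := Finset.sum_nonneg fun a _ => by positivity
  -- With radii `R^{uᵢ}` every other monomial is smaller than `x^v` by a factor of at least `R`, and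
  -- `R` is chosen so that `M / R ≤ ‖c_v‖ / 4`.
  set R : ℝ := 1 + 4 * M / ‖f.coeff v‖ with hR
  have hR1 : 1 ≤ R := by
    have : 0 ≤ 4 * M / ‖f.coeff v‖ := by positivity
    linarith
  have hR0 : 0 < R := by linarith
  have hprod : ∀ a : Fin (m + 1) → ℤ, ∏ i, (R ^ u i) ^ a i = R ^ (∑ i, u i * a i) := by
    intro a
    simp_rw [← zpow_mul]
    induction (Finset.univ : Finset (Fin (m + 1))) using Finset.induction_on with
    | empty => simp
    | insert i s hi ih => rw [Finset.prod_insert hi, Finset.sum_insert hi, zpow_add₀ hR0.ne', ih]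
  refine ⟨⟨v, (-v 0).toNat, fun i => R ^ u i, hv, by omega, by omega, hmin,
    fun i => zpow_pos hR0 _, ?_⟩⟩
  simp only [hprod]
  calc _ ≤ ∑ a ∈ f.coeff.support.erase v, ‖f.coeff a‖ * (1 + ((a 0 - v 0).toNat : ℝ)) *
        R ^ (∑ i, u i * v i - 1) := by
        refine Finset.sum_le_sum fun a ha => ?_
        rw [Finset.mem_erase] at ha
        have := hu a ha.2 ha.1
        refine mul_le_mul_of_nonneg_left (zpow_le_zpow_right₀ hR1 (by omega)) (by positivity)
    _ = M * (R ^ (∑ i, u i * v i) / R) := by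
        rw [← Finset.sum_mul, zpow_sub_one₀ hR0.ne', div_eq_mul_inv]
    _ = M / R * R ^ (∑ i, u i * v i) := by ring
    _ ≤ 1 / 4 * ‖f.coeff v‖ * R ^ (∑ i, u i * v i) := by
        refine mul_le_mul_of_nonneg_right ?_ (zpow_nonneg hR0.le _)
        rw [div_le_iff₀ hR0, hR]
        have : 1 / 4 * ‖f.coeff v‖ * (1 + 4 * M / ‖f.coeff v‖) = 1 / 4 * ‖f.coeff v‖ + M := by
          field_simp
        rw [this]
        linarith
    _ = _ := by ring

/-! ### The equation of the fibre in torus coordinates -/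

/-- The character `θ ↦ exp (2πi ∑ⱼ a_{j+1} θⱼ)` of the torus of the last `m` variables. -/
def character {m : ℕ} (a : Fin (m + 1) → ℤ) (θ : Fin m → ℝ) : ℂ :=
  Complex.exp (2 * Real.pi * Complex.I * ∑ j, (a j.succ : ℂ) * (θ j : ℂ))

lemma norm_character {m : ℕ} (a : Fin (m + 1) → ℤ) (θ : Fin m → ℝ) : ‖character a θ‖ = 1 := by
  have : 2 * (Real.pi : ℂ) * Complex.I * ∑ j, (a j.succ : ℂ) * (θ j : ℂ) =
      ((2 * Real.pi * ∑ j, (a j.succ : ℝ) * θ j : ℝ) : ℂ) * Complex.I := by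
    push_cast; ring
  rw [character, this, Complex.norm_exp_ofReal_mul_I]

lemma character_ne_zero {m : ℕ} (a : Fin (m + 1) → ℤ) (θ : Fin m → ℝ) : character a θ ≠ 0 :=
  Complex.exp_ne_zero _

lemma character_sub {m : ℕ} (a b : Fin (m + 1) → ℤ) (θ : Fin m → ℝ) :
    character (a - b) θ * character b θ = character a θ := by
  simp only [character, ← Complex.exp_add, ← mul_add, ← Finset.sum_add_distrib, ← add_mul]
  congr 3
  simp

lemma character_eq_of_sub_int {m : ℕ} (a : Fin (m + 1) → ℤ) {θ θ' : Fin m → ℝ}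
    (h : ∀ j, ∃ k : ℤ, θ' j = θ j + k) : character a θ' = character a θ := by
  choose k hk using h
  rw [character, character, Complex.exp_eq_exp_iff_exists_int]
  refine ⟨∑ j, a j.succ * k j, ?_⟩
  push_cast
  simp only [hk, Complex.ofReal_add, Complex.ofReal_intCast, mul_add, Finset.sum_add_distrib]
  ring

lemma contDiff_character {m : ℕ} (a : Fin (m + 1) → ℤ) : ContDiff ℝ (⊤ : ℕ∞) (character a) := by
  unfold character
  refine ContDiff.cexp (contDiff_const.mul (ContDiff.sum fun j _ => contDiff_const.mul ?_))
  exact Complex.ofRealCLM.contDiff.comp (contDiff_apply ℝ ℝ j)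

namespace DominantTerm

variable {m : ℕ} {f : LaurentPoly ℂ (m + 1)} (T : DominantTerm f)

/-- The coefficient of the term of exponent `a`, rescaled by the radii. -/
def scaledCoeff (a : Fin (m + 1) → ℤ) : ℂ := f.coeff a * ((∏ i, T.r i ^ a i : ℝ) : ℂ)

lemma prod_pos (a : Fin (m + 1) → ℤ) : 0 < ∏ i, T.r i ^ a i :=
  Finset.prod_pos fun i _ => zpow_pos (T.r_pos i) _

lemma scaledCoeff_v_ne_zero : T.scaledCoeff T.v ≠ 0 :=
  mul_ne_zero (Finsupp.mem_support_iff.1 T.v_mem)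
    (Complex.ofReal_ne_zero.2 (ne_of_gt (T.prod_pos T.v)))

/-- The point with coordinates `r₀ s` and `rⱼ exp (2πi θⱼ)`. -/
def point (s : ℂ) (θ : Fin m → ℝ) : Fin (m + 1) → ℂ :=
  Fin.cons (T.r 0 * s) fun j => T.r j.succ * Complex.exp (2 * Real.pi * Complex.I * θ j)

lemma point_ne_zero {s : ℂ} (hs : s ≠ 0) (θ : Fin m → ℝ) (i : Fin (m + 1)) :
    T.point s θ i ≠ 0 := by
  have h : ∀ i, (T.r i : ℂ) ≠ 0 := fun i => by exact_mod_cast (T.r_pos i).ne'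
  refine Fin.cases ?_ (fun j => ?_) i
  · exact mul_ne_zero (h 0) hs
  · exact mul_ne_zero (h _) (Complex.exp_ne_zero _)

lemma monom_point (a : Fin (m + 1) → ℤ) (s : ℂ) (θ : Fin m → ℝ) :
    monom a (T.point s θ) = ((∏ i, T.r i ^ a i : ℝ) : ℂ) * s ^ a 0 * character a θ := by
  rw [monom, Fin.prod_univ_succ, Fin.prod_univ_succ, character, Finset.mul_sum, Complex.exp_sum]
  simp only [point, Fin.cons_zero, Fin.cons_succ, mul_zpow, Finset.prod_mul_distrib]
  push_cast
  have : ∀ j : Fin m, Complex.exp (2 * Real.pi * Complex.I * θ j) ^ a j.succ =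
      Complex.exp (2 * Real.pi * Complex.I * (a j.succ * θ j)) := by
    intro j
    rw [← Complex.exp_int_mul]
    congr 1; ring
  simp only [this]
  ring

/-- `f = c_v x^v (1 + perturb)`. -/
def perturb (p : ℂ × (Fin m → ℝ)) : ℂ :=
  ∑ a ∈ f.coeff.support.erase T.v, T.scaledCoeff a / T.scaledCoeff T.v *
    (p.1 ^ (a 0 - T.v 0).toNat * character (a - T.v) p.2)

/-- The derivative of `perturb` in the first variable. -/
def perturbDeriv (p : ℂ × (Fin m → ℝ)) : ℂ :=
  ∑ a ∈ f.coeff.support.erase T.v, T.scaledCoeff a / T.scaledCoeff T.v *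
    (((a 0 - T.v 0).toNat * p.1 ^ ((a 0 - T.v 0).toNat - 1)) * character (a - T.v) p.2)

lemma eval_point {s : ℂ} (hs : s ≠ 0) (θ : Fin m → ℝ) :
    eval f (T.point s θ) =
      T.scaledCoeff T.v * character T.v θ * (1 + T.perturb (s, θ)) / s ^ T.N := by
  have hterm : ∀ a, f.coeff a * monom a (T.point s θ) = T.scaledCoeff a * s ^ a 0 * character a θ := by
    intro a
    rw [monom_point, scaledCoeff]; ring
  rw [eval, Finsupp.sum]
  simp only [hterm]
  rw [← Finset.add_sum_erase _ _ T.v_mem, perturb, mul_add, add_div, Finset.mul_sum, Finset.sum_div]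
  congr 1
  · rw [T.v_zero, zpow_neg, zpow_natCast]; ring
  · refine Finset.sum_congr rfl fun a ha => ?_
    have hle := T.le_of_mem a (Finset.mem_of_mem_erase ha)
    have h1 : s ^ a 0 = s ^ (a 0 - T.v 0).toNat / s ^ T.N := by
      rw [← zpow_natCast, ← zpow_natCast, ← zpow_sub₀ hs]
      congr 1
      have := T.v_zero
      omega
    rw [h1, ← character_sub a T.v θ]
    have := T.scaledCoeff_v_ne_zero
    field_simp

/-- The weight `1 + d`, with `d` the power of `s`, dominates both `1` and `d`; so one estimate
bounds the perturbation and its derivative in `s`. -/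
lemma sum_norm_le : ∑ a ∈ f.coeff.support.erase T.v, ‖T.scaledCoeff a / T.scaledCoeff T.v‖ *
    (1 + ((a 0 - T.v 0).toNat : ℝ)) ≤ 1 / 4 := by
  have hn : ∀ a, ‖T.scaledCoeff a‖ = ‖f.coeff a‖ * ∏ i, T.r i ^ a i := by
    intro a
    rw [scaledCoeff, norm_mul, Complex.norm_real, Real.norm_of_nonneg (T.prod_pos a).le]
  have hpos : 0 < ‖T.scaledCoeff T.v‖ := norm_pos_iff.2 T.scaledCoeff_v_ne_zero
  have := T.bound
  rw [← hn] at this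
  rw [← div_le_iff₀ hpos, Finset.sum_div] at this
  refine (Finset.sum_congr rfl fun a _ => ?_).trans_le this
  rw [norm_div, hn a]
  ring

lemma norm_perturb_le {s : ℂ} (hs : ‖s‖ ≤ 1) (θ : Fin m → ℝ) : ‖T.perturb (s, θ)‖ ≤ 1 / 4 := by
  refine (norm_sum_le _ _).trans (le_trans (Finset.sum_le_sum fun a _ => ?_) T.sum_norm_le)
  rw [norm_mul, norm_mul, norm_character, norm_pow, mul_one]
  refine mul_le_mul_of_nonneg_left ?_ (norm_nonneg _)
  have := pow_le_one₀ (n := (a 0 - T.v 0).toNat) (norm_nonneg s) hs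
  have h0 : (0 : ℝ) ≤ (a 0 - T.v 0).toNat := Nat.cast_nonneg _
  linarith

lemma norm_perturbDeriv_le {s : ℂ} (hs : ‖s‖ ≤ 1) (θ : Fin m → ℝ) :
    ‖T.perturbDeriv (s, θ)‖ ≤ 1 / 4 := by
  refine (norm_sum_le _ _).trans (le_trans (Finset.sum_le_sum fun a _ => ?_) T.sum_norm_le)
  rw [norm_mul, norm_mul, norm_character, norm_mul, norm_pow, mul_one, Complex.norm_natCast]
  refine mul_le_mul_of_nonneg_left ?_ (norm_nonneg _)
  have := pow_le_one₀ (n := (a 0 - T.v 0).toNat - 1) (norm_nonneg s) hs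
  have h0 : (0 : ℝ) ≤ (a 0 - T.v 0).toNat := Nat.cast_nonneg _
  nlinarith

lemma hasDerivAt_perturb (s : ℂ) (θ : Fin m → ℝ) :
    HasDerivAt (fun s => T.perturb (s, θ)) (T.perturbDeriv (s, θ)) s := by
  unfold perturb perturbDeriv
  refine HasDerivAt.fun_sum fun a _ => ?_
  dsimp only
  exact ((hasDerivAt_pow _ s).mul_const _).const_mul _

lemma contDiff_perturb : ContDiff ℝ (⊤ : ℕ∞) T.perturb := by
  unfold perturb
  refine ContDiff.sum fun a _ => contDiff_const.mul ((contDiff_fst.pow _).mul ?_)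
  exact (contDiff_character _).comp contDiff_snd

lemma continuous_perturbDeriv : Continuous T.perturbDeriv := by
  unfold perturbDeriv
  refine continuous_finsetSum _ fun a _ => continuous_const.mul (.mul (by fun_prop) ?_)
  exact (contDiff_character _).continuous.comp continuous_snd

/-- `log (1 + perturb) / N`. -/
def exponent (p : ℂ × (Fin m → ℝ)) : ℂ := Complex.log (1 + T.perturb p) / T.N

/-- The derivative of `exponent` in the first variable. -/
def exponentDeriv (p : ℂ × (Fin m → ℝ)) : ℂ := T.perturbDeriv p / (1 + T.perturb p) / T.N

lemma norm_one_add_perturb {s : ℂ} (hs : ‖s‖ ≤ 1) (θ : Fin m → ℝ) :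
    3 / 4 ≤ ‖1 + T.perturb (s, θ)‖ ∧ ‖1 + T.perturb (s, θ)‖ ≤ 5 / 4 := by
  have h := T.norm_perturb_le hs θ
  have h1 := norm_sub_norm_le (1 : ℂ) (-T.perturb (s, θ))
  have h2 := norm_add_le (1 : ℂ) (T.perturb (s, θ))
  rw [norm_neg, sub_neg_eq_add] at h1
  rw [norm_one] at h1 h2
  constructor <;> linarith

lemma one_add_perturb_mem_slitPlane {s : ℂ} (hs : ‖s‖ ≤ 1) (θ : Fin m → ℝ) :
    1 + T.perturb (s, θ) ∈ Complex.slitPlane :=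
  Complex.mem_slitPlane_of_norm_lt_one ((T.norm_perturb_le hs θ).trans_lt (by norm_num))

lemma exp_exponent_pow {s : ℂ} (hs : ‖s‖ ≤ 1) (θ : Fin m → ℝ) :
    Complex.exp (T.exponent (s, θ)) ^ T.N = 1 + T.perturb (s, θ) := by
  have hN : (T.N : ℂ) ≠ 0 := by exact_mod_cast T.N_pos.ne'
  rw [← Complex.exp_nat_mul, exponent, mul_div_cancel₀ _ hN,
    Complex.exp_log (Complex.slitPlane_ne_zero (T.one_add_perturb_mem_slitPlane hs θ))]

lemma continuousOn_exponentDeriv : ContinuousOn T.exponentDeriv (ball 0 1 ×ˢ univ) := by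
  refine ContinuousOn.div_const (T.continuous_perturbDeriv.continuousOn.div
    (continuousOn_const.add T.contDiff_perturb.continuous.continuousOn) ?_) _
  rintro ⟨s, θ⟩ ⟨hs, -⟩
  exact Complex.slitPlane_ne_zero (T.one_add_perturb_mem_slitPlane (mem_ball_zero_iff.1 hs).le θ)

theorem isInvertibleExponent : IsInvertibleExponent T.exponent T.exponentDeriv where
  contDiffOn := by
    unfold exponent
    refine ContDiffOn.div_const ?_ _
    rintro ⟨s, θ⟩ ⟨hs, -⟩
    have h1 : ContDiffAt ℝ (⊤ : ℕ∞) Complex.log (1 + T.perturb (s, θ)) :=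
      (Complex.contDiffAt_log
        (T.one_add_perturb_mem_slitPlane (mem_ball_zero_iff.1 hs).le θ)).restrict_scalars ℝ
    exact (h1.comp (s, θ) (contDiff_const.add T.contDiff_perturb).contDiffAt).contDiffWithinAt
  hasDerivAt s hs θ := by
    exact (((T.hasDerivAt_perturb s θ).const_add 1).clog
      (T.one_add_perturb_mem_slitPlane (mem_ball_zero_iff.1 hs).le θ)).div_const _
  norm_deriv_le s hs θ := by
    have hs' := (mem_ball_zero_iff.1 hs).le
    have hN : (1 : ℝ) ≤ T.N := by exact_mod_cast T.N_pos
    rw [exponentDeriv, norm_div, norm_div, Complex.norm_natCast]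
    have h1 := (T.norm_one_add_perturb hs' θ).1
    have h2 := T.norm_perturbDeriv_le hs' θ
    rw [div_le_iff₀ (by linarith), div_le_iff₀ (by linarith)]
    nlinarith
  norm_exp_le s hs θ := by
    have hs' := (mem_ball_zero_iff.1 hs).le
    by_contra! hlt
    have h1 := congrArg norm (T.exp_exponent_pow hs' θ)
    rw [norm_pow] at h1
    have h2 := (T.norm_one_add_perturb hs' θ).2
    have h3 := le_self_pow₀ (a := ‖Complex.exp (T.exponent (s, θ))‖) (by linarith) T.N_pos.ne'
    linarith

/-- The solution `s` of `s = w * exp (exponent (s, θ))`. -/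
def root (w : ℂ) (θ : Fin m → ℝ) : ℂ := IsInvertibleExponent.solution T.exponent (w, θ)

lemma norm_root_lt {w : ℂ} (hw : ‖w‖ < 1 / 2) (θ : Fin m → ℝ) : ‖T.root w θ‖ < 1 :=
  mem_ball_zero_iff.1 (T.isInvertibleExponent.solution_mem hw θ)

lemma root_ne_zero {w : ℂ} (hw : ‖w‖ < 1 / 2) (hw0 : w ≠ 0) (θ : Fin m → ℝ) : T.root w θ ≠ 0 :=
  T.isInvertibleExponent.solution_ne_zero hw hw0 θ

/-- The root satisfies `s^N = w^N (1 + perturb)`, which cancels the perturbation: in the coordinate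
`w` the function `f` is a pure power. This gives both the points of `Y_t` and the later change of
variables. -/
lemma eval_point_root {w : ℂ} (hw : ‖w‖ < 1 / 2) (hw0 : w ≠ 0) (θ : Fin m → ℝ) :
    eval f (T.point (T.root w θ) θ) = T.scaledCoeff T.v * character T.v θ / w ^ T.N := by
  have h0 := T.root_ne_zero hw hw0 θ
  have hne := Complex.slitPlane_ne_zero (T.one_add_perturb_mem_slitPlane (T.norm_root_lt hw θ).le θ)
  have h1 : T.root w θ ^ T.N = w ^ T.N * (1 + T.perturb (T.root w θ, θ)) := by
    conv_lhs => rw [root, T.isInvertibleExponent.solution_eq hw θ]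
    rw [mul_pow]
    congr 1
    exact T.exp_exponent_pow (T.norm_root_lt hw θ).le θ
  rw [T.eval_point h0, h1]
  have := pow_ne_zero T.N hw0
  field_simp

/-- The equation is periodic in `θ` and its small solution is unique. -/
lemma root_eq_of_sub_int {θ θ' : Fin m → ℝ} (h : ∀ j, ∃ k : ℤ, θ' j = θ j + k) {w : ℂ}
    (hw : ‖w‖ < 1 / 2) :
    T.root w θ' = T.root w θ := by
  have : ∀ s, T.exponent (s, θ') = T.exponent (s, θ) := by
    intro s
    simp only [exponent, perturb, character_eq_of_sub_int _ h]
  refine T.isInvertibleExponent.eq_of_eq hw (T.isInvertibleExponent.solution_mem hw θ')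
    (T.isInvertibleExponent.solution_mem hw θ) (θ := θ) ?_ (T.isInvertibleExponent.solution_eq hw θ)
  rw [← this]
  exact T.isInvertibleExponent.solution_eq hw θ'

end DominantTerm

end LaurentPencil

/-! ### The cycle on the fibre -/

namespace LaurentPencil
open Metric Set Filter Topology

lemma sum_range_add_int {M : Type*} [AddCommGroup M] {g : ℤ → M} {N : ℕ}
    (hg : ∀ k, g (k + N) = g k) (c : ℤ) :
    ∑ k ∈ Finset.range N, g (k + c) = ∑ k ∈ Finset.range N, g k := by
  have step : ∀ c : ℤ, ∑ k ∈ Finset.range N, g (k + (c + 1)) = ∑ k ∈ Finset.range N, g (k + c) := by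
    intro c
    have h1 := Finset.sum_range_succ (fun k : ℕ => g (k + c)) N
    have h2 := Finset.sum_range_succ' (fun k : ℕ => g (k + c)) N
    rw [h1] at h2
    have h3 : g ((N : ℤ) + c) = g (((0 : ℕ) : ℤ) + c) := by
      rw [add_comm, hg]; simp
    rw [h3] at h2
    have h4 := add_right_cancel h2
    rw [h4]
    refine Finset.sum_congr rfl fun k _ => ?_
    congr 1
    push_cast
    ring
  induction c using Int.induction_on with
  | zero => simp
  | succ i ih => rw [step, ih]
  | pred i ih =>
    rw [← ih, ← step]
    simp

lemma boundary_sum_single {X : Type} {k : ℕ} {ι : Type*} (s : Finset ι) (σ : ι → SCube X (k + 1)) :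
    SChain.boundary (∑ j ∈ s, Finsupp.single (σ j) (1 : ℤ)) =
      ∑ i : Fin (k + 1), (-1 : ℤ) ^ (i : ℕ) •
        (∑ j ∈ s, Finsupp.single ((σ j).face i 1) (1 : ℤ) -
          ∑ j ∈ s, Finsupp.single ((σ j).face i 0) 1) := by
  rw [SChain.boundary, ← Finsupp.sum_finsetSum_index (by simp) (fun σ a b => by rw [add_smul])]
  simp only [Finsupp.sum_single_index, zero_smul, one_smul]
  rw [Finset.sum_comm]
  simp only [← Finset.smul_sum, Finset.sum_sub_distrib]

lemma integralChain_sum_single {n k : ℕ} {ι : Type*} (s : Finset ι) (η : Form n k)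
    (σ : ι → SCube (Fin n → ℂ) k) :
    integralChain η (∑ j ∈ s, Finsupp.single (σ j) (1 : ℤ)) = ∑ j ∈ s, integralCube η (σ j) := by
  rw [integralChain, ← Finsupp.sum_finsetSum_index (by simp) (fun σ a b => by push_cast; ring)]
  simp

namespace DominantTerm

variable {m : ℕ} {f : LaurentPoly ℂ (m + 1)} (T : DominantTerm f)

/-- The branch number `k` of the `N`-th root of `κ ^ N * character v θ`. -/
def branch (κ : ℂ) (k : ℤ) (θ : Fin m → ℝ) : ℂ :=
  κ * Complex.exp (2 * Real.pi * Complex.I * ((k + ∑ j, (T.v j.succ : ℂ) * (θ j : ℂ)) / T.N))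

lemma norm_branch (κ : ℂ) (k : ℤ) (θ : Fin m → ℝ) : ‖T.branch κ k θ‖ = ‖κ‖ := by
  have : 2 * (Real.pi : ℂ) * Complex.I * ((k + ∑ j, (T.v j.succ : ℂ) * (θ j : ℂ)) / T.N) =
      ((2 * Real.pi * ((k + ∑ j, (T.v j.succ : ℝ) * θ j) / T.N) : ℝ) : ℂ) * Complex.I := by
    push_cast; ring
  rw [branch, norm_mul, this, Complex.norm_exp_ofReal_mul_I, mul_one]

lemma natCast_N_ne_zero : (T.N : ℂ) ≠ 0 := by exact_mod_cast T.N_pos.ne'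

lemma branch_pow (κ : ℂ) (k : ℤ) (θ : Fin m → ℝ) :
    T.branch κ k θ ^ T.N = κ ^ T.N * character T.v θ := by
  rw [branch, mul_pow, ← Complex.exp_nat_mul, character]
  congr 1
  rw [Complex.exp_eq_exp_iff_exists_int]
  refine ⟨k, ?_⟩
  have := T.natCast_N_ne_zero
  field_simp
  ring

lemma branch_add_N (κ : ℂ) (k : ℤ) (θ : Fin m → ℝ) :
    T.branch κ (k + T.N) θ = T.branch κ k θ := by
  rw [branch, branch]
  congr 1
  rw [Complex.exp_eq_exp_iff_exists_int]
  refine ⟨1, ?_⟩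
  have := T.natCast_N_ne_zero
  field_simp
  push_cast
  ring

/-- The monodromy of the `N`-th root of `χ_v`: a loop in `θⱼ` multiplies it by a root of unity,
which only relabels the branches. -/
lemma branch_add_int (κ : ℂ) (k : ℤ) {θ θ' : Fin m → ℝ} {d : Fin m → ℤ} (h : ∀ j, θ' j = θ j + d j) :
    T.branch κ k θ' = T.branch κ (k + ∑ j, T.v j.succ * d j) θ := by
  rw [branch, branch]
  congr 4
  push_cast
  simp only [h, Complex.ofReal_add, Complex.ofReal_intCast, mul_add, Finset.sum_add_distrib]
  ring

/-- The point of the branch number `k` of the cycle over the point `θ` of the torus. -/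
def cyclePoint (κ : ℂ) (k : ℤ) (θ : Fin m → ℝ) : Fin (m + 1) → ℂ :=
  T.point (T.root (T.branch κ k θ) θ) θ

lemma cyclePoint_mem_fiber {κ t : ℂ} (hκ : ‖κ‖ < 1 / 2) (hκ0 : κ ≠ 0)
    (hκt : κ ^ T.N = t * T.scaledCoeff T.v) (k : ℤ) (θ : Fin m → ℝ) :
    T.cyclePoint κ k θ ∈ fiber f t := by
  have hb : ‖T.branch κ k θ‖ < 1 / 2 := by rwa [T.norm_branch]
  have hb0 : T.branch κ k θ ≠ 0 := by rw [← norm_pos_iff, T.norm_branch]; exact norm_pos_iff.2 hκ0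
  refine ⟨T.point_ne_zero (T.root_ne_zero hb hb0 θ) θ, ?_⟩
  rw [pencilFun, cyclePoint, T.eval_point_root hb hb0, T.branch_pow, hκt]
  have h1 : t * T.scaledCoeff T.v ≠ 0 := by rw [← hκt]; exact pow_ne_zero _ hκ0
  have h2 := character_ne_zero T.v θ
  have h3 := left_ne_zero_of_mul h1
  have h4 := right_ne_zero_of_mul h1
  field_simp
  ring

lemma cyclePoint_add_N (κ : ℂ) (k : ℤ) (θ : Fin m → ℝ) :
    T.cyclePoint κ (k + T.N) θ = T.cyclePoint κ k θ := by
  rw [cyclePoint, branch_add_N, cyclePoint]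

lemma point_eq_of_sub_int (s : ℂ) {θ θ' : Fin m → ℝ} (h : ∀ j, ∃ k : ℤ, θ' j = θ j + k) :
    T.point s θ' = T.point s θ := by
  ext i
  refine Fin.cases rfl (fun j => ?_) i
  simp only [point, Fin.cons_succ]
  congr 1
  obtain ⟨k, hk⟩ := h j
  rw [Complex.exp_eq_exp_iff_exists_int]
  refine ⟨k, ?_⟩
  rw [hk]
  push_cast
  ring

lemma cyclePoint_add_int {κ : ℂ} (hκ : ‖κ‖ < 1 / 2) (k : ℤ) {θ θ' : Fin m → ℝ} {d : Fin m → ℤ}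
    (h : ∀ j, θ' j = θ j + d j) :
    T.cyclePoint κ k θ' = T.cyclePoint κ (k + ∑ j, T.v j.succ * d j) θ := by
  have h' : ∀ j, ∃ k : ℤ, θ' j = θ j + k := fun j => ⟨d j, h j⟩
  rw [cyclePoint, cyclePoint, T.branch_add_int κ k h, T.point_eq_of_sub_int _ h',
    T.root_eq_of_sub_int h' (by rwa [T.norm_branch])]

lemma contDiff_branch (k : ℤ) :
    ContDiff ℝ (⊤ : ℕ∞) fun p : ℂ × (Fin m → ℝ) => T.branch p.1 k p.2 := by
  unfold branch
  refine contDiff_fst.mul (ContDiff.cexp (contDiff_const.mul (ContDiff.div_const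
    (contDiff_const.add (ContDiff.sum fun j _ => contDiff_const.mul ?_)) _)))
  exact Complex.ofRealCLM.contDiff.comp ((contDiff_apply ℝ ℝ j).comp contDiff_snd)

lemma contDiffAt_root {p : ℂ × (Fin m → ℝ)} (hp : ‖p.1‖ < 1 / 2) :
    ContDiffAt ℝ (⊤ : ℕ∞) (fun p : ℂ × (Fin m → ℝ) => T.root p.1 p.2) p :=
  T.isInvertibleExponent.contDiffAt_solution hp p.2

lemma contDiffAt_root_branch (k : ℤ) {p : ℂ × (Fin m → ℝ)} (hp : ‖p.1‖ < 1 / 2) :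
    ContDiffAt ℝ (⊤ : ℕ∞) (fun p : ℂ × (Fin m → ℝ) => T.root (T.branch p.1 k p.2) p.2) p :=
  ContDiffAt.comp (g := fun p : ℂ × (Fin m → ℝ) => T.root p.1 p.2)
    (f := fun p : ℂ × (Fin m → ℝ) => (T.branch p.1 k p.2, p.2)) p
    (T.contDiffAt_root (by rwa [T.norm_branch])) ((T.contDiff_branch k).prodMk contDiff_snd).contDiffAt

lemma contDiffAt_cyclePoint (k : ℤ) {p : ℂ × (Fin m → ℝ)} (hp : ‖p.1‖ < 1 / 2) :
    ContDiffAt ℝ (⊤ : ℕ∞) (fun p : ℂ × (Fin m → ℝ) => T.cyclePoint p.1 k p.2) p := by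
  rw [contDiffAt_pi]
  refine Fin.cases ?_ (fun j => ?_)
  · exact contDiffAt_const.mul (T.contDiffAt_root_branch k hp)
  · have : ContDiff ℝ (⊤ : ℕ∞) fun p : ℂ × (Fin m → ℝ) =>
        (T.r j.succ : ℂ) * Complex.exp (2 * Real.pi * Complex.I * p.2 j) :=
      contDiff_const.mul (ContDiff.cexp (contDiff_const.mul
        (Complex.ofRealCLM.contDiff.comp ((contDiff_apply ℝ ℝ j).comp contDiff_snd))))
    exact this.contDiffAt

/-- The cubes of the cycle. -/
def cycleCube (κ : ℂ) (k : ℤ) : SCube (Fin (m + 1) → ℂ) m :=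
  fun θ => T.cyclePoint κ k fun j => (θ j : ℝ)

lemma cycleCube_clampCube (κ : ℂ) (k : ℤ) {θ : Fin m → ℝ} (hθ : θ ∈ Icc (0 : Fin m → ℝ) 1) :
    T.cycleCube κ k (clampCube θ) = T.cyclePoint κ k θ := by
  rw [cycleCube]
  congr 1
  ext j
  rw [clampCube, projIcc_of_mem zero_le_one ⟨hθ.1 j, hθ.2 j⟩]

/-- The face `θᵢ = 1` of one branch is the face `θᵢ = 0` of the branch to which the monodromy leads.
The shift permutes the residues modulo `N`, so opposite faces cancel in the sum and the boundary is
zero even before degenerate cubes are divided out. -/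
lemma isCycle_sum_cycleCube {κ : ℂ} (hκ : ‖κ‖ < 1 / 2) :
    SChain.IsCycle (∑ k ∈ Finset.range T.N, Finsupp.single (T.cycleCube κ k) (1 : ℤ)) := by
  cases m with
  | zero => trivial
  | succ m =>
    change SChain.boundary _ ∈ degenerateChains _ _
    have hface : ∀ (i : Fin (m + 1)) (k : ℤ), SCube.face (T.cycleCube κ k) i 1 =
        SCube.face (T.cycleCube κ (k + T.v i.succ)) i 0 := by
      intro i k
      ext1 θ
      have := T.cyclePoint_add_int hκ k
        (θ := fun j => ((i.insertNth (α := fun _ => unitInterval) 0 θ j : unitInterval) : ℝ))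
        (θ' := fun j => ((i.insertNth (α := fun _ => unitInterval) 1 θ j : unitInterval) : ℝ))
        (d := Pi.single i 1) (fun j => by
          refine Fin.succAboveCases i ?_ (fun j => ?_) j <;> simp)
      simp only [Pi.single_apply, mul_ite, mul_one, mul_zero, Finset.sum_ite_eq', Finset.mem_univ,
        if_true] at this
      exact this
    rw [boundary_sum_single]
    have : ∀ i : Fin (m + 1), ∑ k ∈ Finset.range T.N,
        Finsupp.single (SCube.face (T.cycleCube κ k) i 1) (1 : ℤ) =
        ∑ k ∈ Finset.range T.N, Finsupp.single (SCube.face (T.cycleCube κ k) i 0) (1 : ℤ) := by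
      intro i
      simp only [hface]
      refine sum_range_add_int (g := fun k => Finsupp.single (SCube.face (T.cycleCube κ k) i 0)
        (1 : ℤ)) (fun k => ?_) _
      have : T.cycleCube κ (k + T.N) = T.cycleCube κ k := by
        ext1 θ
        exact T.cyclePoint_add_N κ k _
      simp only [this]
    simp only [this, sub_self, smul_zero, Finset.sum_const_zero]
    exact zero_mem _

/-- The family of cycles given by a smooth `N`-th root `κ` of `t c_v r^v`. -/
def cycleFamily {D : Set ℂ} (κ : ℂ → ℂ) (hsm : ContDiffOn ℝ (⊤ : ℕ∞) κ D)
    (hκ : ∀ t ∈ D, ‖κ t‖ < 1 / 2) (hκ0 : ∀ t ∈ D, κ t ≠ 0)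
    (hκt : ∀ t ∈ D, κ t ^ T.N = t * T.scaledCoeff T.v) : CycleFamily f D where
  size := T.N
  coef _ := 1
  cube k t := T.cycleCube (κ t) (k : ℕ)
  smooth k := by
    have h : ContDiffOn ℝ (⊤ : ℕ∞)
        (fun p : ℂ × (Fin m → ℝ) => T.cyclePoint (κ p.1) (k : ℕ) p.2) (D ×ˢ Icc 0 1) := by
      intro p hp
      have h1 : ContDiffWithinAt ℝ (⊤ : ℕ∞) (fun p : ℂ × (Fin m → ℝ) => (κ p.1, p.2))
          (D ×ˢ Icc 0 1) p :=
        ContDiffWithinAt.prodMk ((hsm p.1 hp.1).comp p contDiff_fst.contDiffWithinAt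
          fun q hq => hq.1) contDiff_snd.contDiffWithinAt
      exact (T.contDiffAt_cyclePoint (k : ℕ) (p := (κ p.1, p.2)) (hκ p.1 hp.1)).comp_contDiffWithinAt
        p h1
    exact h.congr fun p hp => T.cycleCube_clampCube _ _ hp.2
  mem_fiber k t ht θ := T.cyclePoint_mem_fiber (hκ t ht) (hκ0 t ht) (hκt t ht) _ _
  isCycle t ht := by
    have := T.isCycle_sum_cycleCube (hκ t ht)
    rwa [Finset.sum_range] at this

lemma period_cycleFamily {D : Set ℂ} (ω : RelativeForm m) (κ : ℂ → ℂ)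
    (hsm : ContDiffOn ℝ (⊤ : ℕ∞) κ D)
    (hκ : ∀ t ∈ D, ‖κ t‖ < 1 / 2) (hκ0 : ∀ t ∈ D, κ t ≠ 0)
    (hκt : ∀ t ∈ D, κ t ^ T.N = t * T.scaledCoeff T.v) (t : ℂ) :
    period ω (T.cycleFamily κ hsm hκ hκ0 hκt) t =
      ∑ k ∈ Finset.range T.N, integralCube (ω.at t) (T.cycleCube (κ t) k) := by
  rw [Finset.sum_range]
  exact integralChain_sum_single Finset.univ (ω.at t) fun k : Fin T.N => T.cycleCube (κ t) (k : ℕ)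

end DominantTerm

end LaurentPencil

/-! ### Pullback of the residue form to the cycle -/

namespace LaurentPencil
open Metric Set Filter Topology

lemma uniqueDiffOn_Icc_pi (m : ℕ) : UniqueDiffOn ℝ (Icc (0 : Fin m → ℝ) 1) := by
  rw [← pi_univ_Icc]
  exact UniqueDiffOn.univ_pi fun i => uniqueDiffOn_Icc (by simp)

/-- The value of `dlog x₀ ∧ … ∧ dlog x_m` on `∂/∂x₀` and `m` vectors whose last coordinates are
diagonal. -/
lemma dlogVol_cons {m : ℕ} {x : Fin (m + 1) → ℂ} (hx : ∀ i, x i ≠ 0) {V : Fin m → Fin (m + 1) → ℂ}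
    {c : ℂ} (hV : ∀ i j, V j i.succ = if i = j then c * x i.succ else 0) :
    dlogVol (m + 1) x (Fin.cons (Pi.single 0 1) V) = (x 0)⁻¹ * c ^ m := by
  let M : Matrix (Fin (m + 1)) (Fin (m + 1)) ℂ :=
    fun j k => (x k)⁻¹ * (Fin.cons (Pi.single 0 1) V : Fin (m + 1) → Fin (m + 1) → ℂ) j k
  -- The row of `∂/∂x₀` vanishes off the diagonal, and the other rows can do so only in column `0`.
  have hM : M.BlockTriangular OrderDual.toDual := by
    intro i j hij
    rw [OrderDual.toDual_lt_toDual] at hij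
    simp only [M]
    refine mul_eq_zero_of_right _ ?_
    revert hij
    refine Fin.cases (by simp) (fun j => ?_) j
    refine Fin.cases (by simp) (fun i => ?_) i
    intro hij
    rw [Fin.succ_lt_succ_iff] at hij
    simp [hV, hij.ne']
  change M.det = _
  rw [Matrix.det_of_isLowerTriangular M hM, Fin.prod_univ_succ]
  simp [M, hV, hx, mul_comm]

lemma wedgeCovector_cons {n k : ℕ} (α : (Fin n → ℂ) →ₗ[ℂ] ℂ) (η : (Fin n → ℂ) [⋀^Fin k]→ₗ[ℂ] ℂ)
    (e : Fin n → ℂ) {V : Fin k → Fin n → ℂ} (hV : ∀ j, α (V j) = 0) :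
    wedgeCovector α η (Fin.cons e V) = α e * η V := by
  rw [wedgeCovector, AlternatingMap.alternatizeUncurryFin_apply, Fin.sum_univ_succ]
  simp [hV, Fin.removeNth_zero]

namespace DominantTerm

variable {m : ℕ} {f : LaurentPoly ℂ (m + 1)} (T : DominantTerm f)

/-- The logarithmic derivative `w S'(w) / S(w)` of the root `S`. -/
def rootLogDeriv (w : ℂ) (θ : Fin m → ℝ) : ℂ :=
  (1 - T.root w θ * T.exponentDeriv (T.root w θ, θ))⁻¹

lemma hasDerivAt_point (s : ℂ) (θ : Fin m → ℝ) :
    HasDerivAt (fun s => T.point s θ) ((T.r 0 : ℂ) • Pi.single 0 1) s := by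
  rw [hasDerivAt_pi]
  refine Fin.cases ?_ (fun j => ?_)
  · simpa [point] using (hasDerivAt_id s).const_mul (T.r 0 : ℂ)
  · simpa [point] using hasDerivAt_const s _

/-- Here `F = 1 - t A (1 + P) / s^N` in the variable `s`. On `F = 0` the derivative `s ∂F/∂s`
reduces to `N - s P' / (1 + P)`, which is `N` times `1 - s · exponentDeriv`. -/
lemma fderiv_pencilFun_mul {κ t : ℂ} (hκ : ‖κ‖ < 1 / 2) (hκ0 : κ ≠ 0)
    (hκt : κ ^ T.N = t * T.scaledCoeff T.v) (k : ℤ) (θ : Fin m → ℝ) :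
    fderiv ℂ (pencilFun f t) (T.cyclePoint κ k θ) (Pi.single 0 1) * T.cyclePoint κ k θ 0 =
      T.N * (T.rootLogDeriv (T.branch κ k θ) θ)⁻¹ := by
  set x := T.cyclePoint κ k θ with hx
  have hmem : x ∈ fiber f t := T.cyclePoint_mem_fiber hκ hκ0 hκt k θ
  have hb : ‖T.branch κ k θ‖ < 1 / 2 := by rwa [T.norm_branch]
  have hb0 : T.branch κ k θ ≠ 0 := by rw [← norm_pos_iff, T.norm_branch]; exact norm_pos_iff.2 hκ0
  set s := T.root (T.branch κ k θ) θ with hs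
  have hs0 : s ≠ 0 := T.root_ne_zero hb hb0 θ
  have hs1 : ‖s‖ < 1 := T.norm_root_lt hb θ
  have hF : DifferentiableAt ℂ (pencilFun f t) x :=
    (((hasFDerivAt_eval f hmem.1).const_mul t).const_sub 1).differentiableAt
  have h1 : HasDerivAt (fun s => pencilFun f t (T.point s θ))
      (fderiv ℂ (pencilFun f t) x ((T.r 0 : ℂ) • Pi.single 0 1)) s :=
    HasFDerivAt.comp_hasDerivAt (f := fun s => T.point s θ) s hF.hasFDerivAt (T.hasDerivAt_point s θ)
  have h2 : HasDerivAt (fun s => 1 - t * (T.scaledCoeff T.v * character T.v θ *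
      (1 + T.perturb (s, θ)) / s ^ T.N)) (-(t * ((T.scaledCoeff T.v * character T.v θ *
      T.perturbDeriv (s, θ) * s ^ T.N - T.scaledCoeff T.v * character T.v θ *
      (1 + T.perturb (s, θ)) * (T.N * s ^ (T.N - 1))) / (s ^ T.N) ^ 2))) s :=
    (((((T.hasDerivAt_perturb s θ).const_add 1).const_mul _).div (hasDerivAt_pow _ s)
      (pow_ne_zero _ hs0)).const_mul t).const_sub 1
  have h3 : (fun s => pencilFun f t (T.point s θ)) =ᶠ[𝓝 s] fun s =>
      1 - t * (T.scaledCoeff T.v * character T.v θ * (1 + T.perturb (s, θ)) / s ^ T.N) := by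
    filter_upwards [isOpen_ne.mem_nhds hs0] with s' hs'
    rw [pencilFun, T.eval_point hs']
  have h4 := h1.unique (h2.congr_of_eventuallyEq h3)
  have h5 : 1 - t * (T.scaledCoeff T.v * character T.v θ * (1 + T.perturb (s, θ)) / s ^ T.N) = 0 := by
    rw [← T.eval_point hs0]
    exact hmem.2
  have hp := Complex.slitPlane_ne_zero (T.one_add_perturb_mem_slitPlane hs1.le θ)
  have hN := T.natCast_N_ne_zero
  rw [map_smul, smul_eq_mul] at h4
  have hx0 : x 0 = T.r 0 * s := rfl
  have hpow : s ^ (T.N - 1) * s = s ^ T.N := pow_sub_one_mul T.N_pos.ne' s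
  rw [hx0, mul_left_comm, ← mul_assoc, h4, rootLogDeriv, inv_inv, exponentDeriv, ← hs]
  have hsN := pow_ne_zero T.N hs0
  generalize T.perturb (s, θ) = P at *
  generalize T.perturbDeriv (s, θ) = P' at *
  generalize T.scaledCoeff T.v * character T.v θ = A at *
  have h6 : t * A * (1 + P) = s ^ T.N := by
    field_simp at h5
    linear_combination -h5
  have h7 : t * A = s ^ T.N / (1 + P) := by
    rw [← h6]; field_simp
  calc _ = -(t * A * (P' * s ^ T.N * s - (1 + P) * (T.N * (s ^ (T.N - 1) * s)))) / (s ^ T.N) ^ 2 := by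
        ring
    _ = _ := by
        rw [hpow, h7]
        field_simp
        ring

/-- The pullback of the residue form to the cubes of the cycle. -/
lemma residue_pullback {ω : RelativeForm m} {κ t : ℂ} (hω : IsResidueAt f ω t) (hκ : ‖κ‖ < 1 / 2)
    (hκ0 : κ ≠ 0) (hκt : κ ^ T.N = t * T.scaledCoeff T.v) (k : ℤ) {θ : Fin m → ℝ}
    (hθ : θ ∈ Icc (0 : Fin m → ℝ) 1) :
    (ω.at t (T.cycleCube κ k (clampCube θ)) fun j =>
      fderivWithin ℝ (fun θ' => T.cycleCube κ k (clampCube θ')) (Icc 0 1) θ (Pi.single j 1)) =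
      (T.N : ℂ)⁻¹ * T.rootLogDeriv (T.branch κ k θ) θ := by
  have hX : DifferentiableAt ℝ (T.cyclePoint κ k) θ := by
    have h1 : ContDiffAt ℝ (⊤ : ℕ∞) (T.cyclePoint κ k) θ :=
      ContDiffAt.comp (g := fun p : ℂ × (Fin m → ℝ) => T.cyclePoint p.1 k p.2)
        (f := fun θ => (κ, θ)) θ (T.contDiffAt_cyclePoint k (p := (κ, θ)) hκ) (by fun_prop)
    exact h1.differentiableAt (by simp)
  rw [fderivWithin_congr (fun θ' hθ' => T.cycleCube_clampCube κ k hθ')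
    (T.cycleCube_clampCube κ k hθ), fderivWithin_eq_fderiv (uniqueDiffOn_Icc_pi m θ hθ) hX,
    T.cycleCube_clampCube κ k hθ]
  set x := T.cyclePoint κ k θ with hx
  set V : Fin m → Fin (m + 1) → ℂ := fun j => fderiv ℝ (T.cyclePoint κ k) θ (Pi.single j 1) with hVdef
  have hmem : x ∈ fiber f t := T.cyclePoint_mem_fiber hκ hκ0 hκt k θ
  have hF : DifferentiableAt ℂ (pencilFun f t) x :=
    (((hasFDerivAt_eval f hmem.1).const_mul t).const_sub 1).differentiableAt
  -- `cyclePoint` lies in `Y_t` for every real `θ`, also outside the unit cube, so `F` is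
  -- identically zero along it.
  have hαV : ∀ j, (fderiv ℂ (pencilFun f t) x : (Fin (m + 1) → ℂ) →ₗ[ℂ] ℂ) (V j) = 0 := by
    have h1 : HasFDerivAt (fun θ => pencilFun f t (T.cyclePoint κ k θ))
        (((fderiv ℂ (pencilFun f t) x).restrictScalars ℝ).comp (fderiv ℝ (T.cyclePoint κ k) θ)) θ :=
      HasFDerivAt.comp (g := pencilFun f t) θ (hF.hasFDerivAt.restrictScalars ℝ) hX.hasFDerivAt
    have h2 : (fun θ => pencilFun f t (T.cyclePoint κ k θ)) = fun _ => 0 :=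
      funext fun θ => (T.cyclePoint_mem_fiber hκ hκ0 hκt k θ).2
    rw [h2] at h1
    have h3 := h1.unique (hasFDerivAt_const _ _)
    intro j
    exact congrArg (fun A : (Fin m → ℝ) →L[ℝ] ℂ => A (Pi.single j 1)) h3
  have hV : ∀ i j, V j i.succ = if i = j then 2 * Real.pi * Complex.I * x i.succ else 0 := by
    intro i j
    have h1 : HasFDerivAt (fun θ => T.cyclePoint κ k θ i.succ)
        ((ContinuousLinearMap.proj i.succ).comp (fderiv ℝ (T.cyclePoint κ k) θ)) θ :=
      HasFDerivAt.comp θ (ContinuousLinearMap.proj (R := ℝ) (φ := fun _ : Fin (m + 1) => ℂ)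
        i.succ).hasFDerivAt hX.hasFDerivAt
    have h2 : HasFDerivAt (fun θ : Fin m → ℝ => (T.r i.succ : ℂ) *
        Complex.exp (2 * Real.pi * Complex.I * θ i)) ((T.r i.succ : ℂ) •
        (Complex.exp (2 * Real.pi * Complex.I * θ i) • ((2 * (Real.pi : ℂ) * Complex.I) •
        (Complex.ofRealCLM.comp (ContinuousLinearMap.proj (R := ℝ) (φ := fun _ : Fin m => ℝ) i))))) θ :=
      (((Complex.ofRealCLM.comp (ContinuousLinearMap.proj (R := ℝ)
        (φ := fun _ : Fin m => ℝ) i)).hasFDerivAt.const_mul _).cexp).const_mul _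
    have h3 := congrArg (fun A : (Fin m → ℝ) →L[ℝ] ℂ => A (Pi.single j 1)) (h1.unique h2)
    change V j i.succ = _ at h3
    rw [h3]
    have hxi : x i.succ = T.r i.succ * Complex.exp (2 * Real.pi * Complex.I * θ i) := rfl
    rw [hxi]
    by_cases hij : i = j
    · subst hij
      simp
      ring
    · simp [hij]
  -- The residue identity is evaluated on `∂/∂x₀` and the tangent vectors of the cube. Since `dF`
  -- kills the latter, only `∂F/∂x₀ · ω(V)` remains on the left; the factor `(2πi)^m` from the
  -- angular coordinates cancels the normalization on the right.
  have hres := congrArg (fun A => A (Fin.cons (Pi.single 0 1) V)) (hω x hmem)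
  simp only [AlternatingMap.smul_apply] at hres
  rw [wedgeCovector_cons _ _ _ hαV, dlogVol_cons hmem.1 hV, smul_eq_mul] at hres
  have hfd := T.fderiv_pencilFun_mul hκ hκ0 hκt k θ
  rw [← hx] at hfd
  have hx0 := hmem.1 0
  have hpi : (2 * (Real.pi : ℂ) * Complex.I) ^ m ≠ 0 := pow_ne_zero _ Complex.two_pi_I_ne_zero
  have hprod : fderiv ℂ (pencilFun f t) x (Pi.single 0 1) * x 0 * (ω.at t x V) = 1 := by
    have : fderiv ℂ (pencilFun f t) x (Pi.single 0 1) * ω.at t x V = (x 0)⁻¹ := by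
      refine hres.trans ?_
      field_simp
    rw [mul_right_comm, this, inv_mul_cancel₀ hx0]
  rw [hfd] at hprod
  rw [eq_comm, ← mul_one ((T.N : ℂ)⁻¹ * _), ← hprod]
  have hne := left_ne_zero_of_mul_eq_one hprod
  have hN := T.natCast_N_ne_zero
  have hG : T.rootLogDeriv (T.branch κ k θ) θ ≠ 0 := fun h0 =>
    right_ne_zero_of_mul hne (by rw [h0, inv_zero])
  field_simp

lemma integralCube_cycleCube {ω : RelativeForm m} {κ t : ℂ} (hω : IsResidueAt f ω t)
    (hκ : ‖κ‖ < 1 / 2) (hκ0 : κ ≠ 0) (hκt : κ ^ T.N = t * T.scaledCoeff T.v) (k : ℤ) :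
    integralCube (ω.at t) (T.cycleCube κ k) =
      ∫ θ in Icc (0 : Fin m → ℝ) 1, (T.N : ℂ)⁻¹ * T.rootLogDeriv (T.branch κ k θ) θ :=
  MeasureTheory.setIntegral_congr_fun measurableSet_Icc fun _ hθ =>
    T.residue_pullback hω hκ hκ0 hκt k hθ

end DominantTerm

end LaurentPencil

/-! ### Expansion of the period into constant terms -/

namespace LaurentPencil
open Metric Set Filter Topology MeasureTheory

lemma integral_Icc_exp_int (k : ℤ) :
    ∫ x in Icc (0 : ℝ) 1, Complex.exp (2 * Real.pi * Complex.I * (k * x)) = if k = 0 then 1 else 0 := by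
  rw [integral_Icc_eq_integral_Ioc, ← intervalIntegral.integral_of_le zero_le_one]
  split_ifs with hk
  · simp [hk]
  · have hc : 2 * (Real.pi : ℂ) * Complex.I * k ≠ 0 :=
      mul_ne_zero Complex.two_pi_I_ne_zero (by exact_mod_cast hk)
    have h := integral_exp_mul_complex (a := 0) (b := 1) hc
    simp only [mul_assoc] at h ⊢
    rw [h]
    have : Complex.exp (2 * (Real.pi * (Complex.I * (k * ((1 : ℝ) : ℂ))))) = 1 := by
      rw [Complex.exp_eq_one_iff]
      exact ⟨k, by push_cast; ring⟩
    rw [this]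
    simp

/-- The characters of the torus are orthogonal to the trivial one. -/
lemma integral_character {m : ℕ} (a : Fin (m + 1) → ℤ) :
    ∫ θ in Icc (0 : Fin m → ℝ) 1, character a θ = if ∀ j : Fin m, a j.succ = 0 then 1 else 0 := by
  rw [← pi_univ_Icc, volume_pi, Measure.restrict_pi_pi]
  have h : ∀ θ : Fin m → ℝ, character a θ =
      ∏ j, Complex.exp (2 * Real.pi * Complex.I * (a j.succ * θ j)) := by
    intro θ
    rw [character, Finset.mul_sum, Complex.exp_sum]
  simp only [h]
  rw [integral_fintype_prod_eq_prod
    (fun (j : Fin m) (x : ℝ) => Complex.exp (2 * Real.pi * Complex.I * (a j.succ * x)))]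
  simp only [Pi.zero_apply, Pi.one_apply, integral_Icc_exp_int]
  rw [Finset.prod_ite_zero]
  simp

namespace DominantTerm

variable {m : ℕ} {f : LaurentPoly ℂ (m + 1)} (T : DominantTerm f)

lemma hasDerivAt_root {w : ℂ} (hw : ‖w‖ < 1 / 2) (θ : Fin m → ℝ) :
    HasDerivAt (fun w => T.root w θ)
      (Complex.exp (T.exponent (T.root w θ, θ)) * T.rootLogDeriv w θ) w := by
  simpa only [root, rootLogDeriv, div_eq_mul_inv] using
    T.isInvertibleExponent.hasDerivAt_solution hw θ

lemma root_eq {w : ℂ} (hw : ‖w‖ < 1 / 2) (θ : Fin m → ℝ) :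
    T.root w θ = w * Complex.exp (T.exponent (T.root w θ, θ)) :=
  T.isInvertibleExponent.solution_eq hw θ

lemma rootLogDeriv_zero (θ : Fin m → ℝ) : T.rootLogDeriv 0 θ = 1 := by
  rw [rootLogDeriv, T.root_eq (w := 0) (by simp) θ]
  simp

lemma norm_rootLogDeriv_le {w : ℂ} (hw : ‖w‖ < 1 / 2) (θ : Fin m → ℝ) :
    ‖T.rootLogDeriv w θ‖ ≤ 3 / 2 := by
  have h := (T.isInvertibleExponent.one_sub_ne_zero
    (mem_ball_zero_iff.2 (T.norm_root_lt hw θ)) θ).1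
  rw [rootLogDeriv, norm_inv]
  refine (inv_anti₀ (by norm_num) h).trans (by norm_num)

lemma differentiableOn_rootLogDeriv (θ : Fin m → ℝ) :
    DifferentiableOn ℂ (fun w => T.rootLogDeriv w θ) (ball 0 (1 / 2)) := by
  have hS : DifferentiableOn ℂ (fun w => T.root w θ) (ball 0 (1 / 2)) := fun w hw =>
    (T.hasDerivAt_root (mem_ball_zero_iff.1 hw) θ).differentiableAt.differentiableWithinAt
  have hℓ : DifferentiableOn ℂ (fun w => Complex.exp (-T.exponent (T.root w θ, θ)))
      (ball 0 (1 / 2)) := by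
    intro w hw
    have hw' := mem_ball_zero_iff.1 hw
    exact ((T.isInvertibleExponent.hasDerivAt (T.root w θ)
      (mem_ball_zero_iff.2 (T.norm_root_lt hw' θ)) θ).comp w
      (T.hasDerivAt_root hw' θ)).neg.cexp.differentiableAt.differentiableWithinAt
  -- Holomorphy is read off from `w S'/S = S' exp(-exponent)`, where `S'` is the derivative of a
  -- holomorphic function.
  refine ((hS.deriv isOpen_ball).mul hℓ).congr fun w hw => ?_
  simp only [Pi.mul_apply]
  rw [(T.hasDerivAt_root (mem_ball_zero_iff.1 hw) θ).deriv, mul_right_comm, ← Complex.exp_add,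
    add_neg_cancel, Complex.exp_zero, one_mul]

lemma hasSum_rootLogDeriv {R : ℝ} (hR : R < 1 / 2) {w : ℂ} (hw : ‖w‖ < R) (θ : Fin m → ℝ) :
    HasSum (fun n : ℕ => ∮ z in C(0, R), (w / z) ^ n * (z⁻¹ * T.rootLogDeriv z θ))
      (2 * Real.pi * Complex.I * T.rootLogDeriv w θ) := by
  have hR0 : 0 < R := (norm_nonneg w).trans_lt hw
  have hd : DifferentiableOn ℂ (fun w => T.rootLogDeriv w θ) (closedBall 0 R) :=
    (T.differentiableOn_rootLogDeriv θ).mono (closedBall_subset_ball hR)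
  have h1 := hasSum_two_pi_I_cauchyPowerSeries_integral (c := 0) (R := R) (w := w)
    (f := fun w => T.rootLogDeriv w θ)
    ((hd.continuousOn.mono sphere_subset_closedBall).circleIntegrable hR0.le) hw
  have h2 := hd.circleIntegral_sub_inv_smul (w := w) (mem_ball_zero_iff.2 hw)
  simp only [zero_add] at h1
  rw [h2] at h1
  simpa only [sub_zero, smul_eq_mul] using h1

/-- The integrand is `S^b dlog S`. For `b ≠ 0` it has the single-valued primitive `S^b / b`; for `b
= 0` Cauchy's formula at the centre applies, where `w S'/S` equals `1`. -/
lemma integral_root_zpow {R : ℝ} (hR0 : 0 < R) (hR : R < 1 / 2) (θ : Fin m → ℝ) (b : ℤ) :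
    ∮ z in C(0, R), T.root z θ ^ b * (z⁻¹ * T.rootLogDeriv z θ) =
      if b = 0 then 2 * Real.pi * Complex.I else 0 := by
  split_ifs with hb
  · subst hb
    have h := T.hasSum_rootLogDeriv hR (w := 0) (by simpa using hR0) θ
    rw [T.rootLogDeriv_zero, mul_one] at h
    rw [← h.tsum_eq, tsum_eq_single 0]
    · simp
    · intro n hn
      simp [hn, circleIntegral]
  · refine circleIntegral.integral_eq_zero_of_hasDerivWithinAt hR0.le
      (f := fun z => T.root z θ ^ b / b) fun z hz => ?_
    rw [mem_sphere_zero_iff_norm] at hz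
    have hz1 : ‖z‖ < 1 / 2 := by rwa [hz]
    have hz0 : z ≠ 0 := by rw [← norm_pos_iff, hz]; exact hR0
    have hS0 := T.root_ne_zero hz1 hz0 θ
    have hd := ((hasDerivAt_zpow b (T.root z θ) (Or.inl hS0)).comp z
      (T.hasDerivAt_root hz1 θ)).div_const (b : ℂ)
    refine (hd.congr_deriv ?_).hasDerivWithinAt
    have hb' : (b : ℂ) ≠ 0 := by exact_mod_cast hb
    have he : Complex.exp (T.exponent (T.root z θ, θ)) = T.root z θ / z := by
      conv_rhs => rw [T.root_eq hz1 θ]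
      field_simp
    rw [he, zpow_sub_one₀ hS0]
    field_simp

/-- The terms of degree zero in the first variable. -/
def partialConstTerm (g : LaurentPoly ℂ (m + 1)) (θ : Fin m → ℝ) : ℂ :=
  ∑ a ∈ g.coeff.support, if a 0 = 0 then
    g.coeff a * ((∏ i, T.r i ^ a i : ℝ) : ℂ) * character a θ else 0

lemma continuous_partialConstTerm (g : LaurentPoly ℂ (m + 1)) :
    Continuous (T.partialConstTerm g) := by
  unfold partialConstTerm
  refine continuous_finsetSum _ fun a _ => ?_
  split_ifs
  · exact continuous_const.mul (contDiff_character a).continuous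
  · exact continuous_const

lemma integral_partialConstTerm (g : LaurentPoly ℂ (m + 1)) :
    ∫ θ in Icc (0 : Fin m → ℝ) 1, T.partialConstTerm g θ = g.coeff 0 := by
  have hterm : ∀ a : Fin (m + 1) → ℤ, ∫ θ in Icc (0 : Fin m → ℝ) 1, (if a 0 = 0 then
      g.coeff a * ((∏ i, T.r i ^ a i : ℝ) : ℂ) * character a θ else 0) =
      if a = 0 then g.coeff 0 else 0 := by
    intro a
    by_cases h0 : a 0 = 0
    · simp only [h0, if_true]
      rw [integral_const_mul, integral_character]
      by_cases ha : a = 0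
      · subst ha
        simp
      · rw [if_neg ha, if_neg, mul_zero]
        intro h
        exact ha (funext fun i => Fin.cases h0 h i)
    · have ha : a ≠ 0 := fun ha => h0 (by rw [ha]; rfl)
      simp [h0, ha]
  unfold partialConstTerm
  rw [integral_finsetSum]
  · simp only [hterm]
    rw [Finset.sum_ite_eq']
    split_ifs with h
    · rfl
    · exact (Finsupp.notMem_support_iff.1 h).symm
  · intro a _
    refine Continuous.integrableOn_Icc ?_
    split_ifs
    · exact continuous_const.mul (contDiff_character a).continuous
    · exact continuous_const

/-- The change of variable from `w` to `s = S(w, θ)`: integration against `dlog S` extracts the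
constant term in `x₀`, term by term. -/
lemma integral_eval_root {R : ℝ} (hR0 : 0 < R) (hR : R < 1 / 2) (θ : Fin m → ℝ)
    (g : LaurentPoly ℂ (m + 1)) :
    ∮ z in C(0, R), eval g (T.point (T.root z θ) θ) * (z⁻¹ * T.rootLogDeriv z θ) =
      2 * Real.pi * Complex.I * T.partialConstTerm g θ := by
  have hcont : ∀ b : ℤ, ContinuousOn (fun z => T.root z θ ^ b * (z⁻¹ * T.rootLogDeriv z θ))
      (sphere 0 R) := by
    intro b z hz
    rw [mem_sphere_zero_iff_norm] at hz
    have hz1 : ‖z‖ < 1 / 2 := by rwa [hz]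
    have hz0 : z ≠ 0 := by rw [← norm_pos_iff, hz]; exact hR0
    have hS0 := T.root_ne_zero hz1 hz0 θ
    have hG : ContinuousAt (fun w => T.rootLogDeriv w θ) z :=
      ((T.differentiableOn_rootLogDeriv θ).differentiableAt
        (isOpen_ball.mem_nhds (mem_ball_zero_iff.2 hz1))).continuousAt
    exact (((T.hasDerivAt_root hz1 θ).continuousAt.zpow₀ b (Or.inl hS0)).mul
      ((continuousAt_inv₀ hz0).mul hG)).continuousWithinAt
  have h : ∀ z, eval g (T.point (T.root z θ) θ) * (z⁻¹ * T.rootLogDeriv z θ) =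
      ∑ a ∈ g.coeff.support, (g.coeff a * ((∏ i, T.r i ^ a i : ℝ) : ℂ) * character a θ) *
        (T.root z θ ^ a 0 * (z⁻¹ * T.rootLogDeriv z θ)) := by
    intro z
    rw [eval, Finsupp.sum, Finset.sum_mul]
    refine Finset.sum_congr rfl fun a _ => ?_
    rw [T.monom_point]
    ring
  simp only [h]
  rw [circleIntegral.integral_fun_sum fun a _ =>
    (continuousOn_const.mul (hcont (a 0))).circleIntegrable hR0.le]
  rw [partialConstTerm, Finset.mul_sum]
  refine Finset.sum_congr rfl fun a _ => ?_
  rw [circleIntegral.integral_const_mul, T.integral_root_zpow hR0 hR]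
  split_ifs
  · ring
  · simp

lemma branch_eq_mul (κ : ℂ) (k : ℕ) (θ : Fin m → ℝ) :
    T.branch κ k θ = Complex.exp (2 * Real.pi * Complex.I / T.N) ^ k * T.branch κ 0 θ := by
  rw [branch, branch, ← Complex.exp_nat_mul, mul_left_comm, ← Complex.exp_add]
  congr 2
  push_cast
  ring

lemma sum_exp_pow_mul (n : ℕ) :
    ∑ k ∈ Finset.range T.N, (Complex.exp (2 * Real.pi * Complex.I / T.N) ^ k) ^ n =
      if T.N ∣ n then (T.N : ℂ) else 0 := by
  have hprim := Complex.isPrimitiveRoot_exp T.N T.N_pos.ne'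
  set ζ := Complex.exp (2 * Real.pi * Complex.I / T.N)
  have h : ∀ k, (ζ ^ k) ^ n = (ζ ^ n) ^ k := fun k => pow_right_comm ζ k n
  simp only [h]
  split_ifs with hd
  · rw [hprim.pow_eq_one_iff_dvd n |>.2 hd]
    simp
  · have hne : ζ ^ n ≠ 1 := fun h1 => hd ((hprim.pow_eq_one_iff_dvd n).1 h1)
    rw [geom_sum_eq hne, ← pow_mul, mul_comm, pow_mul, hprim.pow_eq_one]
    simp

/-- On the circle `(branch / z)^N = t c χ_v / z^N`, which is `t f` at the point of the root; its
`i`-th power is therefore a value of `t^i f^i`. -/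
lemma integral_branch_pow {κ t : ℂ} (hκt : κ ^ T.N = t * T.scaledCoeff T.v)
    {R : ℝ} (hR0 : 0 < R) (hR : R < 1 / 2) (θ : Fin m → ℝ) (i : ℕ) :
    ∮ z in C(0, R), (T.branch κ 0 θ / z) ^ (T.N * i) * (z⁻¹ * T.rootLogDeriv z θ) =
      2 * Real.pi * Complex.I * (t ^ i * T.partialConstTerm (f ^ i) θ) := by
  rw [mul_left_comm, ← T.integral_eval_root hR0 hR, ← circleIntegral.integral_const_mul]
  refine circleIntegral.integral_congr hR0.le fun z hz => ?_
  rw [mem_sphere_zero_iff_norm] at hz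
  have hz1 : ‖z‖ < 1 / 2 := by rwa [hz]
  have hz0 : z ≠ 0 := by rw [← norm_pos_iff, hz]; exact hR0
  rw [eval_pow f (T.point_ne_zero (T.root_ne_zero hz1 hz0 θ) θ), T.eval_point_root hz1 hz0,
    ← mul_assoc (t ^ i), ← mul_pow, pow_mul, div_pow, T.branch_pow, hκt]
  ring

/-- The sum over the branches expands into the partial constant terms of the powers of `f`. -/
lemma hasSum_partialConstTerm {κ t : ℂ} (hκ : ‖κ‖ < 1 / 2)
    (hκt : κ ^ T.N = t * T.scaledCoeff T.v) (θ : Fin m → ℝ) :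
    HasSum (fun i : ℕ => t ^ i * T.partialConstTerm (f ^ i) θ)
      (∑ k ∈ Finset.range T.N, (T.N : ℂ)⁻¹ * T.rootLogDeriv (T.branch κ k θ) θ) := by
  obtain ⟨R, hκR, hR⟩ := exists_between hκ
  have hR0 : 0 < R := (norm_nonneg κ).trans_lt hκR
  have h1 := hasSum_sum (s := Finset.range T.N) fun k _ =>
    T.hasSum_rootLogDeriv hR (w := T.branch κ k θ) (by rwa [T.norm_branch]) θ
  have h2 : ∀ n : ℕ, ∑ k ∈ Finset.range T.N, ∮ z in C(0, R), (T.branch κ k θ / z) ^ n *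
      (z⁻¹ * T.rootLogDeriv z θ) = (if T.N ∣ n then (T.N : ℂ) else 0) *
      ∮ z in C(0, R), (T.branch κ 0 θ / z) ^ n * (z⁻¹ * T.rootLogDeriv z θ) := by
    intro n
    rw [← T.sum_exp_pow_mul n, Finset.sum_mul]
    refine Finset.sum_congr rfl fun k _ => ?_
    rw [← circleIntegral.integral_const_mul]
    refine circleIntegral.integral_congr hR0.le fun z _ => ?_
    rw [T.branch_eq_mul κ k θ, mul_div_assoc, mul_pow, mul_assoc]
  simp only [h2] at h1
  -- Summing over the `N`-th roots of unity has killed all powers not divisible by `N`, so the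
  -- series is reindexed by `n = N i`.
  have hinj : Function.Injective fun i : ℕ => T.N * i := fun i j h =>
    Nat.eq_of_mul_eq_mul_left T.N_pos h
  rw [← hinj.hasSum_iff] at h1
  · have h3 := h1.mul_left ((2 * (Real.pi : ℂ) * Complex.I)⁻¹ * (T.N : ℂ)⁻¹)
    have hpi := Complex.two_pi_I_ne_zero
    have hN := T.natCast_N_ne_zero
    convert! h3 using 1
    · ext i
      simp only [Function.comp_apply, dvd_mul_right, if_true]
      rw [T.integral_branch_pow hκt hR0 hR]
      field_simp
    · rw [← Finset.mul_sum, ← Finset.mul_sum]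
      field_simp
  · intro n hn
    rw [if_neg, zero_mul]
    rintro ⟨i, rfl⟩
    exact hn ⟨i, rfl⟩

/-- A Cauchy estimate. The geometric majorant is independent of `θ`, which permits integrating the
series term by term. -/
lemma norm_partialConstTerm_le {κ t : ℂ} (hκt : κ ^ T.N = t * T.scaledCoeff T.v)
    {R : ℝ} (hκR : ‖κ‖ < R) (hR : R < 1 / 2) (θ : Fin m → ℝ) (i : ℕ) :
    ‖t ^ i * T.partialConstTerm (f ^ i) θ‖ ≤ 3 / 2 * ((‖κ‖ / R) ^ T.N) ^ i := by
  have hR0 : 0 < R := (norm_nonneg κ).trans_lt hκR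
  have h : t ^ i * T.partialConstTerm (f ^ i) θ = (2 * (Real.pi : ℂ) * Complex.I)⁻¹ •
      ∮ z in C(0, R), (T.branch κ 0 θ / z) ^ (T.N * i) * (z⁻¹ * T.rootLogDeriv z θ) := by
    rw [T.integral_branch_pow hκt hR0 hR, smul_eq_mul, inv_mul_cancel_left₀
      Complex.two_pi_I_ne_zero]
  rw [h]
  refine (circleIntegral.norm_two_pi_i_inv_smul_integral_le_of_norm_le_const hR0.le
    (C := (‖κ‖ / R) ^ (T.N * i) * (R⁻¹ * (3 / 2))) fun z hz => ?_).trans ?_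
  · rw [mem_sphere_zero_iff_norm] at hz
    rw [norm_mul, norm_pow, norm_div, T.norm_branch, hz, norm_mul, norm_inv, hz]
    gcongr
    exact T.norm_rootLogDeriv_le (by rwa [hz]) θ
  · rw [← pow_mul]
    refine le_of_eq ?_
    field_simp

lemma continuous_rootLogDeriv_branch {κ : ℂ} (hκ : ‖κ‖ < 1 / 2) (k : ℤ) :
    Continuous fun θ : Fin m → ℝ => T.rootLogDeriv (T.branch κ k θ) θ := by
  have hb : ∀ θ, ‖T.branch κ k θ‖ < 1 / 2 := fun θ => by rwa [T.norm_branch]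
  have hS : Continuous fun θ : Fin m → ℝ => T.root (T.branch κ k θ) θ :=
    continuous_iff_continuousAt.2 fun θ => ContinuousAt.comp
      (g := fun p : ℂ × (Fin m → ℝ) => T.root (T.branch p.1 k p.2) p.2) (f := fun θ => (κ, θ))
      (T.contDiffAt_root_branch k (p := (κ, θ)) hκ).continuousAt (by fun_prop)
  have hℓ : Continuous fun θ : Fin m → ℝ => T.exponentDeriv (T.root (T.branch κ k θ) θ, θ) :=
    T.continuousOn_exponentDeriv.comp_continuous (hS.prodMk continuous_id) fun θ =>
      ⟨mem_ball_zero_iff.2 (T.norm_root_lt (hb θ) θ), mem_univ _⟩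
  exact (continuous_const.sub (hS.mul hℓ)).inv₀ fun θ =>
    (T.isInvertibleExponent.one_sub_ne_zero (mem_ball_zero_iff.2 (T.norm_root_lt (hb θ) θ)) θ).2

/-- The integral of the residue form over the cycle is the sum of the constant terms series. -/
theorem hasSum_constTerm {ω : RelativeForm m} {κ t : ℂ} (hω : IsResidueAt f ω t) (hκ : ‖κ‖ < 1 / 2)
    (hκ0 : κ ≠ 0) (hκt : κ ^ T.N = t * T.scaledCoeff T.v) :
    HasSum (fun i : ℕ => constTerm f i * t ^ i)
      (∑ k ∈ Finset.range T.N, integralCube (ω.at t) (T.cycleCube κ k)) := by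
  obtain ⟨R, hκR, hR⟩ := exists_between hκ
  have hR0 : 0 < R := (norm_nonneg κ).trans_lt hκR
  simp only [T.integralCube_cycleCube hω hκ hκ0 hκt]
  have hintegrable : ∀ k ∈ Finset.range T.N, Integrable (fun θ : Fin m → ℝ =>
      (T.N : ℂ)⁻¹ * T.rootLogDeriv (T.branch κ k θ) θ) (volume.restrict (Icc 0 1)) := fun k _ =>
    (continuous_const.mul (T.continuous_rootLogDeriv_branch hκ k)).integrableOn_Icc
  rw [← integral_finsetSum _ hintegrable]
  have hterm : ∀ i, constTerm f i * t ^ i =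
      ∫ θ in Icc (0 : Fin m → ℝ) 1, t ^ i * T.partialConstTerm (f ^ i) θ := by
    intro i
    rw [integral_const_mul, T.integral_partialConstTerm, constTerm, mul_comm]
  simp only [hterm]
  have hq : (‖κ‖ / R) ^ T.N < 1 :=
    pow_lt_one₀ (by positivity) ((div_lt_one hR0).2 hκR) T.N_pos.ne'
  have hsum : Summable fun i : ℕ => 3 / 2 * ((‖κ‖ / R) ^ T.N) ^ i :=
    (summable_geometric_of_lt_one (by positivity) hq).mul_left _
  refine hasSum_integral_of_dominated_convergence
    (fun i _ => 3 / 2 * ((‖κ‖ / R) ^ T.N) ^ i) (fun i => ?_) (fun i => ?_) ?_ ?_ ?_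
  · exact (continuous_const.mul (T.continuous_partialConstTerm _)).aestronglyMeasurable
  · exact Eventually.of_forall fun θ => T.norm_partialConstTerm_le hκt hκR hR θ i
  · exact Eventually.of_forall fun θ => hsum
  · exact continuous_const.integrableOn_Icc
  · exact Eventually.of_forall fun θ => T.hasSum_partialConstTerm hκ hκt θ

end DominantTerm

end LaurentPencil

/-! ### Taylor series and differential operators -/

namespace LaurentPencil
open Metric Set Filter Topology

/-- `P` is the Taylor series of the analytic function `g` at `0`. -/
def IsTaylorSeries (P : PowerSeries ℂ) (g : ℂ → ℂ) : Prop :=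
  AnalyticAt ℂ g 0 ∧ ∀ n, PowerSeries.coeff n P * n.factorial = iteratedDeriv n g 0

namespace IsTaylorSeries

lemma of_hasSum {c : ℕ → ℂ} {g : ℂ → ℂ} {ε : ℝ} (hε : 0 < ε)
    (h : ∀ t : ℂ, ‖t‖ < ε → HasSum (fun n => c n * t ^ n) (g t)) :
    IsTaylorSeries (PowerSeries.mk c) g := by
  let p := FormalMultilinearSeries.ofScalars ℂ c
  have hr : ENNReal.ofReal (ε / 2) ≤ p.radius := by
    refine p.le_radius_of_summable_norm (r := (ε / 2).toNNReal) ?_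
    have h1 := (h ((ε / 2 : ℝ) : ℂ) (by
      rw [Complex.norm_real, Real.norm_of_nonneg (by positivity)]; linarith)).summable.norm
    refine h1.congr fun n => ?_
    rw [FormalMultilinearSeries.ofScalars_norm, norm_mul, norm_pow, Complex.norm_real,
      Real.norm_of_nonneg (by positivity), Real.coe_toNNReal _ (by positivity)]
  have hball : HasFPowerSeriesOnBall g p 0 (ENNReal.ofReal (ε / 2)) := by
    refine ⟨hr, by simpa using hε, fun {y} hy => ?_⟩
    rw [zero_add]
    have hy' : ‖y‖ < ε / 2 := by
      rw [Metric.eball_ofReal, mem_ball_zero_iff] at hy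
      exact hy
    simpa only [p, FormalMultilinearSeries.ofScalars_apply_eq, smul_eq_mul] using
      h y (by linarith)
  have hat := hball.hasFPowerSeriesAt
  refine ⟨hat.analyticAt, fun n => ?_⟩
  have h1 := hat.eq_formalMultilinearSeries hat.analyticAt.hasFPowerSeriesAt
  have h2 : c n = iteratedDeriv n g 0 / n.factorial :=
    congrFun (FormalMultilinearSeries.ofScalars_series_injective ℂ ℂ h1) n
  rw [PowerSeries.coeff_mk, h2, div_mul_cancel₀]
  exact_mod_cast n.factorial_ne_zero

lemma add {P Q : PowerSeries ℂ} {g h : ℂ → ℂ} (hg : IsTaylorSeries P g) (hh : IsTaylorSeries Q h) :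
    IsTaylorSeries (P + Q) (fun t => g t + h t) := by
  refine ⟨hg.1.add hh.1, fun n => ?_⟩
  rw [iteratedDeriv_fun_add hg.1.contDiffAt hh.1.contDiffAt, map_add, add_mul, hg.2, hh.2]

lemma mul {P Q : PowerSeries ℂ} {g h : ℂ → ℂ} (hg : IsTaylorSeries P g) (hh : IsTaylorSeries Q h) :
    IsTaylorSeries (P * Q) (fun t => g t * h t) := by
  refine ⟨hg.1.mul hh.1, fun n => ?_⟩
  rw [iteratedDeriv_fun_mul hg.1.contDiffAt hh.1.contDiffAt, PowerSeries.coeff_mul,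
    Finset.Nat.sum_antidiagonal_eq_sum_range_succ
      (fun i j => PowerSeries.coeff i P * PowerSeries.coeff j Q), Finset.sum_mul]
  refine Finset.sum_congr rfl fun i hi => ?_
  rw [← hg.2, ← hh.2, ← Nat.choose_mul_factorial_mul_factorial (Finset.mem_range_succ_iff.1 hi)]
  push_cast
  ring

lemma derivative {P : PowerSeries ℂ} {g : ℂ → ℂ} (hg : IsTaylorSeries P g) :
    IsTaylorSeries (PowerSeries.derivative ℂ P) (deriv g) := by
  refine ⟨hg.1.deriv, fun n => ?_⟩
  rw [← iteratedDeriv_succ', ← hg.2, PowerSeries.coeff_derivative, Nat.factorial_succ]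
  push_cast
  ring

lemma iterate_derivative {P : PowerSeries ℂ} {g : ℂ → ℂ} (hg : IsTaylorSeries P g) (k : ℕ) :
    IsTaylorSeries ((PowerSeries.derivative ℂ)^[k] P) (iteratedDeriv k g) := by
  induction k with
  | zero => simpa using hg
  | succ k ih =>
    rw [Function.iterate_succ_apply', iteratedDeriv_succ]
    exact ih.derivative

lemma coe_polynomial (p : Polynomial ℂ) : IsTaylorSeries (p : PowerSeries ℂ) fun t => p.eval t := by
  have hder : ∀ n, iteratedDeriv n (fun t => p.eval t) =
      fun t => (Polynomial.derivative^[n] p).eval t := by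
    intro n
    induction n with
    | zero => simp
    | succ n ih =>
      rw [iteratedDeriv_succ, ih, Function.iterate_succ_apply']
      ext t
      exact Polynomial.deriv _
  refine ⟨?_, fun n => ?_⟩
  · simpa using AnalyticAt.aeval_polynomial (analyticAt_id (𝕜 := ℂ) (z := (0 : ℂ))) p
  · rw [hder, Polynomial.coeff_coe]
    beta_reduce
    rw [← Polynomial.coeff_zero_eq_eval_zero,
      Polynomial.coeff_iterate_derivative]
    simp [Nat.descFactorial_self, mul_comm]

/-- Taking Taylor series is compatible with sums, products and derivatives, hence with differential
operators. -/
lemma applySeries {P : PowerSeries ℂ} {g : ℂ → ℂ} (hg : IsTaylorSeries P g) (L : DiffOp) :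
    IsTaylorSeries (L.applySeries P) (L.applyFun g) := by
  unfold DiffOp.applySeries DiffOp.applyFun Polynomial.sum
  induction L.support using Finset.induction_on with
  | empty =>
    refine ⟨by simpa using analyticAt_const, fun n => by simp⟩
  | insert k s hk ih =>
    simp only [Finset.sum_insert hk]
    exact ((coe_polynomial _).mul (hg.iterate_derivative k)).add ih

/-- The identity theorem carries vanishing over to the centre, where the periods themselves are not
defined. -/
lemma eq_zero {P : PowerSeries ℂ} {g : ℂ → ℂ} (hg : IsTaylorSeries P g)
    (h : ∀ᶠ t in 𝓝[≠] (0 : ℂ), g t = 0) : P = 0 := by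
  have h0 : g =ᶠ[𝓝 0] fun _ => 0 := hg.1.frequently_zero_iff_eventually_zero.1 h.frequently
  ext n
  have h1 := hg.2 n
  rw [h0.iteratedDeriv_eq] at h1
  have hn : (n.factorial : ℂ) ≠ 0 := by exact_mod_cast n.factorial_ne_zero
  simpa [hn] using h1

end IsTaylorSeries

/-! ### Local families of cycles and the main theorem -/

/-- Over a neighbourhood of every small `t₀ ≠ 0` there is a family of cycles whose periods are the
sums of the constant terms series. -/
theorem DominantTerm.exists_cycleFamily {m : ℕ} {f : LaurentPoly ℂ (m + 1)} (T : DominantTerm f)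
    {ω : RelativeForm m} {ε : ℝ} (hω : ∀ t : ℂ, t ≠ 0 → ‖t‖ < ε → IsResidueAt f ω t)
    (hε : ε ≤ (1 / 2) ^ T.N / ‖T.scaledCoeff T.v‖) {t₀ : ℂ} (ht₀ : t₀ ≠ 0) (ht₀ε : ‖t₀‖ < ε) :
    ∃ D : Set ℂ, IsOpen D ∧ t₀ ∈ D ∧ (∀ t ∈ D, t ≠ 0 ∧ ‖t‖ < ε) ∧
      ∃ Δ : CycleFamily f D, ∀ t ∈ D,
        HasSum (fun i : ℕ => constTerm f i * t ^ i) (period ω Δ t) := by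
  set c := T.scaledCoeff T.v with hc
  have hc0 : c ≠ 0 := T.scaledCoeff_v_ne_zero
  -- On the first disc `t / t₀` stays within distance `1` of `1`, off the cut of the logarithm, so
  -- `κ` below is a smooth branch of the `N`-th root of `t c`. The second disc gives `‖κ‖ < 1/2`.
  let D : Set ℂ := ball t₀ ‖t₀‖ ∩ ball 0 ε
  let κ : ℂ → ℂ := fun t => Complex.exp ((Complex.log (t / t₀) + Complex.log (t₀ * c)) / T.N)
  have hDt : ∀ t ∈ D, t / t₀ ∈ Complex.slitPlane := by
    rintro t ⟨ht, -⟩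
    refine Complex.ball_one_subset_slitPlane ?_
    rw [mem_ball, dist_eq_norm] at ht ⊢
    have : t / t₀ - 1 = (t - t₀) / t₀ := by field_simp
    rw [this, norm_div, div_lt_one (norm_pos_iff.2 ht₀)]
    exact ht
  have hD : ∀ t ∈ D, t ≠ 0 ∧ ‖t‖ < ε := by
    intro t ht
    refine ⟨fun h0 => Complex.slitPlane_ne_zero (hDt t ht) (by rw [h0, zero_div]), ?_⟩
    exact mem_ball_zero_iff.1 ht.2
  have hκ0 : ∀ t ∈ D, κ t ≠ 0 := fun t _ => Complex.exp_ne_zero _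
  have hκt : ∀ t ∈ D, κ t ^ T.N = t * c := by
    intro t ht
    rw [← Complex.exp_nat_mul, mul_div_cancel₀ _ T.natCast_N_ne_zero, Complex.exp_add,
      Complex.exp_log (Complex.slitPlane_ne_zero (hDt t ht)), Complex.exp_log (mul_ne_zero ht₀ hc0)]
    field_simp
  have hκ : ∀ t ∈ D, ‖κ t‖ < 1 / 2 := by
    intro t ht
    refine lt_of_pow_lt_pow_left₀ T.N (by norm_num) ?_
    rw [← norm_pow, hκt t ht, norm_mul]
    exact (lt_div_iff₀ (norm_pos_iff.2 hc0)).1 ((hD t ht).2.trans_le hε)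
  have hsm : ContDiffOn ℝ (⊤ : ℕ∞) κ D := by
    intro t ht
    have h1 : ContDiffAt ℂ (⊤ : ℕ∞) (fun t => Complex.log (t / t₀)) t :=
      (Complex.contDiffAt_log (hDt t ht)).comp t (contDiffAt_id.div_const t₀)
    exact (((h1.add contDiffAt_const).div_const _).cexp.restrict_scalars ℝ).contDiffWithinAt
  refine ⟨D, isOpen_ball.inter isOpen_ball,
    ⟨mem_ball_self (norm_pos_iff.2 ht₀), mem_ball_zero_iff.2 ht₀ε⟩, hD,
    T.cycleFamily κ hsm hκ hκ0 hκt, fun t ht => ?_⟩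
  rw [T.period_cycleFamily]
  exact T.hasSum_constTerm (hω t (hD t ht).1 (hD t ht).2) (hκ t ht) (hκ0 t ht) (hκt t ht)

end LaurentPencil

end

theorem mainTheorem4 (m : ℕ) (f : LaurentPencil.LaurentPoly ℂ (m + 1))
    (hf : (0 : Fin (m + 1) → ℝ) ∈ interior (LaurentPencil.newtonPolytope f)) :
    ∃ ω : LaurentPencil.RelativeForm m,
      (∃ ε : ℝ, 0 < ε ∧
        (∀ t : ℂ, t ≠ 0 → ‖t‖ < ε → LaurentPencil.IsResidueAt f ω t) ∧
        ∀ t₀ : ℂ, t₀ ≠ 0 → ‖t₀‖ < ε →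
          ∃ D : Set ℂ, IsOpen D ∧ t₀ ∈ D ∧
            ∃ Δ : LaurentPencil.CycleFamily f D, ∀ t ∈ D,
              HasSum (fun i : ℕ => LaurentPencil.constTerm f i * t ^ i)
                (LaurentPencil.period ω Δ t)) ∧
      ∀ L : LaurentPencil.DiffOp, LaurentPencil.IsPicardFuchs f ω L →
        L.applySeries (LaurentPencil.constTermSeries f) = 0 := by
  obtain ⟨T⟩ := LaurentPencil.exists_dominantTerm f (LaurentPencil.exists_neg_exponent f hf)
  obtain ⟨ω, ε₁, hε₁, hω₁⟩ := LaurentPencil.exists_residueForm f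
  have hε₂ : 0 < (1 / 2 : ℝ) ^ T.N / ‖T.scaledCoeff T.v‖ :=
    div_pos (by positivity) (norm_pos_iff.2 T.scaledCoeff_v_ne_zero)
  let ε := min ε₁ ((1 / 2) ^ T.N / ‖T.scaledCoeff T.v‖)
  have hε : 0 < ε := lt_min hε₁ hε₂
  have hω : ∀ t : ℂ, t ≠ 0 → ‖t‖ < ε → LaurentPencil.IsResidueAt f ω t := fun t ht htε =>
    hω₁ t ht (htε.trans_le (min_le_left _ _))
  have hcycle := fun t₀ (ht₀ : t₀ ≠ 0) (ht₀ε : ‖t₀‖ < ε) =>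
    T.exists_cycleFamily hω (min_le_right _ _) ht₀ ht₀ε
  refine ⟨ω, ⟨ε, hε, hω, fun t₀ ht₀ ht₀ε => ?_⟩, fun L hL => ?_⟩
  · obtain ⟨D, hD, ht₀D, -, Δ, hΔ⟩ := hcycle t₀ ht₀ ht₀ε
    exact ⟨D, hD, ht₀D, Δ, hΔ⟩
  · let g : ℂ → ℂ := fun t => ∑' i : ℕ, LaurentPencil.constTerm f i * t ^ i
    have hg : LaurentPencil.IsTaylorSeries (LaurentPencil.constTermSeries f) g := by
      refine LaurentPencil.IsTaylorSeries.of_hasSum hε fun t htε => Summable.hasSum ?_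
      -- No cycle is available at `t = 0`, where the series has only its constant term.
      by_cases ht : t = 0
      · subst ht
        exact summable_of_ne_finset_zero (s := {0}) fun n hn => by
          simp [Finset.notMem_singleton.1 hn]
      · obtain ⟨D, -, htD, -, Δ, hΔ⟩ := hcycle t ht htε
        exact (hΔ t htD).summable
    refine (hg.applySeries L).eq_zero ?_
    have hball : ∀ᶠ t in nhdsWithin (0 : ℂ) {0}ᶜ, ‖t‖ < ε :=
      nhdsWithin_le_nhds <| Filter.mem_of_superset (Metric.ball_mem_nhds (0 : ℂ) hε)
        fun t ht => mem_ball_zero_iff.1 ht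
    filter_upwards [hball, self_mem_nhdsWithin] with t htε ht
    obtain ⟨D, hD, htD, hDε, Δ, hΔ⟩ := hcycle t ht htε
    have h1 := hL.2 D hD (fun s hs => ⟨(hDε s hs).1, hω s (hDε s hs).1 (hDε s hs).2⟩) Δ t htD
    -- Equality on a neighbourhood is needed, not just at `t`, so that all derivatives entering `L`
    -- agree.
    have h2 : LaurentPencil.period ω Δ =ᶠ[nhds t] g := by
      filter_upwards [hD.mem_nhds htD] with s hs
      exact (hΔ s hs).tsum_eq.symm
    rw [← h1]
    unfold LaurentPencil.DiffOp.applyFun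
    simp only [h2.iteratedDeriv_eq]
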